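/- Let $\mathbf T^3=\mathbf R^3/(2\pi\mathbf Z)^3$ and let $s>5/2$ be real. Let $H^s(\mathbf T^3)$ be the Sobolev space of real functions with norm $\|f\|_s^2=\sum_{n\in\mathbf Z^3}(1+|n|^2)^s|\hat f(n)|^2$, let $H^s(\mathbf T^3,\mathbf R^3)$ be the corresponding space of vector fields with $\|v\|_s^2=\sum_{i=1}^3\|v_i\|_s^2$, and let $H^s_0\subset H^s(\mathbf T^3,\mathbf R^3)$ be the closed subspace of divergence-free fields with mean zero. (Elements of these spaces are identified with their continuous representatives.) Let $\mathbf D$ be the set of volume preserving diffeomorphisms $g$ of $\mathbf T^3$ whose displacement $g-\mathrm{Id}$ lies in $H^s(\mathbf T^3,\mathbf R^3)$ and has mean zero, with the topology given by the $H^s$-norm of displacements, or rather the connected component of $\mathrm{Id}$ in this set. There are $\varepsilon>0$ and $\delta>0$ (depending only on $s$) with the following properties. 1. For every $v\in H^s_0$ with $\|v\|_s<\varepsilon$ there is a function $\varphi\in H^{s+1}(\mathbf T^3)$ such that the map $g_v(x)=x+v(x)+\nabla\varphi(x)$ satisfies $\det g_v'(x)=1$ for all $x$, $g_v\in\mathbf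 D$ and $\|g_v-\mathrm{Id}\|_s<\delta$. It is unique up to an additive constant near the identity: if $\psi\in H^{s+1}(\mathbf T^3)$ is such that $g(x)=x+v(x)+\nabla\psi(x)$ satisfies $\det g'\equiv1$ and $\|g-\mathrm{Id}\|_s<\delta$, then $\psi-\varphi$ is constant. 2. The map $G:v\mapsto g_v-\mathrm{Id}$ is real analytic from $\{v\in H^s_0:\|v\|_s<\varepsilon\}$ to $H^s(\mathbf T^3,\mathbf R^3)$. 3. It gives an analytic chart of $\mathbf D$ near the identity: there is an open neighborhood $U$ of $0$ in $H^s(\mathbf T^3,\mathbf R^3)$ such that $G$ maps $\{v\in H^s_0:\|v\|_s<\varepsilon\}$ bijectively onto $\{g-\mathrm{Id}:g\in\mathbf D\}\cap U$, and the inverse of this bijection is the restriction of a real analytic map $U\to H^s_0$. -/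

import Mathlib

open scoped Gradient

noncomputable section

namespace TorusChart

/-- Euclidean three-space, the universal cover of the torus. -/
abbrev E3 : Type := EuclideanSpace ℝ (Fin 3)

/-- The three-dimensional torus. Mathlib's model is `(ℝ / ℤ)³`; the covering map `toTorus` below
identifies it with `ℝ³ / (2πℤ)³`. -/
abbrev T3 : Type := UnitAddTorus (Fin 3)

/-- The covering map `ℝ³ → T³`, `x ↦ x / 2π mod ℤ³`. Its fibres are the cosets of `(2πℤ)³`, and it
pulls the monomial `UnitAddTorus.mFourier n` back to `x ↦ exp (i n · x)`. -/
def toTorus (x : E3) : T3 := fun i => ((x i / (2 * Real.pi) : ℝ) : UnitAddCircle)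

/-- The invariant probability measure on the torus. -/
def torusMeasure : MeasureTheory.Measure T3 :=
  MeasureTheory.Measure.pi fun _ => AddCircle.haarAddCircle

/-- Fourier coefficients of a real continuous function on the torus. -/
def fc (f : C(T3, ℝ)) (n : Fin 3 → ℤ) : ℂ :=
  UnitAddTorus.mFourierCoeff (fun t => (f t : ℂ)) n

/-- `fc f n` is the average of `exp (-i n · x) f(x)` over the torus. -/
theorem fc_eq_integral (f : C(T3, ℝ)) (n : Fin 3 → ℤ) :
    fc f n = ∫ t, UnitAddTorus.mFourier (-n) t * (f t : ℂ) ∂torusMeasure := rfl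

/-- The weight `1 + |n|²`. -/
def weight (n : Fin 3 → ℤ) : ℝ := 1 + ∑ i, (n i : ℝ) ^ 2

theorem weight_pos (n : Fin 3 → ℤ) : 0 < weight n := by
  unfold weight; positivity

/-- A real continuous function viewed as a complex one. -/
def cplx (f : C(T3, ℝ)) : C(T3, ℂ) := ⟨fun t => (f t : ℂ), by fun_prop⟩

instance : MeasureTheory.IsFiniteMeasure torusMeasure := by unfold torusMeasure; infer_instance

theorem integrable_cont {F : Type*} [NormedAddCommGroup F] (f : C(T3, F)) :
    MeasureTheory.Integrable f torusMeasure :=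
  f.continuous.integrable_of_hasCompactSupport (HasCompactSupport.of_compactSpace _)

theorem fc_add (f g : C(T3, ℝ)) (n : Fin 3 → ℤ) : fc (f + g) n = fc f n + fc g n := by
  simp only [fc_eq_integral]
  refine Eq.trans ?_ (MeasureTheory.integral_add
    (integrable_cont (UnitAddTorus.mFourier (-n) * cplx f))
    (integrable_cont (UnitAddTorus.mFourier (-n) * cplx g)))
  congr 1
  ext t
  simp [mul_add]

theorem fc_smul (c : ℝ) (f : C(T3, ℝ)) (n : Fin 3 → ℤ) : fc (c • f) n = c • fc f n := by
  simp only [fc_eq_integral]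
  rw [← MeasureTheory.integral_smul]
  congr 1
  ext t
  simp [mul_left_comm]

theorem fc_injective (f : C(T3, ℝ)) (h : ∀ n, fc f n = 0) : f = 0 := by
  have h0 : UnitAddTorus.mFourierCoeff (cplx f) = 0 := funext h
  have hs := UnitAddTorus.hasSum_mFourier_series_apply_of_summable (f := cplx f)
    (by rw [h0]; exact summable_zero)
  ext t
  have := (hs t).unique (by simp only [h0, Pi.zero_apply, zero_smul]; exact hasSum_zero)
  simpa [cplx] using this

/-- Square-summability of `(1 + |n|²)^{s/2} f̂(n)`. -/
def MemSobolev (s : ℝ) (f : C(T3, ℝ)) : Prop :=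
  Summable fun n : Fin 3 → ℤ => weight n ^ s * ‖fc f n‖ ^ 2

/-- The weighted Fourier coefficients `(1 + |n|²)^{s/2} f̂(n)`. -/
def wfc (s : ℝ) (f : C(T3, ℝ)) (n : Fin 3 → ℤ) : ℂ := (weight n ^ (s / 2) : ℝ) • fc f n

theorem norm_wfc_sq (s : ℝ) (f : C(T3, ℝ)) (n : Fin 3 → ℤ) :
    ‖wfc s f n‖ ^ 2 = weight n ^ s * ‖fc f n‖ ^ 2 := by
  have h := (weight_pos n).le
  rw [wfc, norm_smul, mul_pow, Real.norm_of_nonneg (Real.rpow_nonneg h _), ← Real.rpow_natCast,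
    ← Real.rpow_mul h]
  norm_num

theorem memSobolev_iff (s : ℝ) (f : C(T3, ℝ)) :
    MemSobolev s f ↔ Memℓp (E := fun _ : Fin 3 → ℤ => ℂ) (wfc s f) 2 := by
  rw [memℓp_gen_iff (by norm_num)]
  simp only [MemSobolev, ← norm_wfc_sq, ENNReal.toReal_ofNat, Real.rpow_ofNat]

theorem wfc_add (s : ℝ) (f g : C(T3, ℝ)) : wfc s (f + g) = wfc s f + wfc s g := by
  ext n; simp [wfc, fc_add]

theorem wfc_smul (s c : ℝ) (f : C(T3, ℝ)) : wfc s (c • f) = c • wfc s f := by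
  ext n; simp [wfc, fc_smul, mul_left_comm]

/-- The functions of class `H^s` as a space of functions. For `s > 3/2` every class of `H^s(T³)` has
exactly one continuous representative, and this space is `H^s(T³)`. Only such `s` are used. -/
def sobolevSubmodule (s : ℝ) : Submodule ℝ C(T3, ℝ) where
  carrier := {f | MemSobolev s f}
  add_mem' {f g} hf hg := by
    simp only [Set.mem_ofPred_eq, memSobolev_iff] at *
    rw [wfc_add]; exact hf.add hg
  zero_mem' := by
    have h : wfc s 0 = 0 := by simpa using wfc_smul s 0 0
    simp only [Set.mem_ofPred_eq, memSobolev_iff, h]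
    exact zero_memℓp
  smul_mem' c f hf := by
    simp only [Set.mem_ofPred_eq, memSobolev_iff] at *
    rw [wfc_smul]; exact hf.const_smul c

/-- The Sobolev space `H^s(T³)` of real functions (`s > 3/2`), a type of its own so that it
carries the Sobolev norm and not the uniform one. -/
def Sobolev (s : ℝ) : Type := sobolevSubmodule s

instance (s : ℝ) : AddCommGroup (Sobolev s) := inferInstanceAs (AddCommGroup (sobolevSubmodule s))

instance (s : ℝ) : Module ℝ (Sobolev s) := inferInstanceAs (Module ℝ (sobolevSubmodule s))

/-- The underlying continuous function. -/
def Sobolev.toC {s : ℝ} : Sobolev s →ₗ[ℝ] C(T3, ℝ) := (sobolevSubmodule s).subtype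

/-- The weighted Fourier transform `H^s(T³) → ℓ²(ℤ³)`. -/
def Sobolev.coeffs (s : ℝ) : Sobolev s →ₗ[ℝ] lp (fun _ : Fin 3 → ℤ => ℂ) 2 where
  toFun f := ⟨wfc s f.toC, (memSobolev_iff s _).1 f.2⟩
  map_add' f g := Subtype.ext (wfc_add s f.toC g.toC)
  map_smul' c f := Subtype.ext (wfc_smul s c f.toC)

theorem Sobolev.coeffs_injective (s : ℝ) : Function.Injective (Sobolev.coeffs s) := by
  rw [injective_iff_map_eq_zero]
  intro f hf
  refine Subtype.ext (fc_injective f.toC fun n => ?_)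
  have h : wfc s f.toC n = 0 := congrArg (fun a : lp (fun _ : Fin 3 → ℤ => ℂ) 2 => a n) hf
  exact (smul_eq_zero.1 h).resolve_left (Real.rpow_pos_of_pos (weight_pos n) _).ne'

/-- The Sobolev norm `‖f‖_s = ‖(1 + |n|²)^{s/2} f̂(n)‖_{ℓ²}`. -/
instance (s : ℝ) : NormedAddCommGroup (Sobolev s) :=
  NormedAddCommGroup.induced (Sobolev s) _ (Sobolev.coeffs s) (Sobolev.coeffs_injective s)

instance (s : ℝ) : NormedSpace ℝ (Sobolev s) :=
  NormedSpace.induced ℝ (Sobolev s) _ (Sobolev.coeffs s)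

theorem Sobolev.norm_sq (s : ℝ) (f : Sobolev s) :
    ‖f‖ ^ 2 = ∑' n : Fin 3 → ℤ, weight n ^ s * ‖fc f.toC n‖ ^ 2 := by
  have h := lp.norm_rpow_eq_tsum (p := 2) (by norm_num) (Sobolev.coeffs s f)
  simp only [ENNReal.toReal_ofNat, Real.rpow_ofNat] at h
  simp only [← norm_wfc_sq]
  exact h

/-- The `(2πℤ)³`-periodic function on `ℝ³` that corresponds to a function on the torus. -/
def Sobolev.lift {s : ℝ} (f : Sobolev s) (x : E3) : ℝ := f.toC (toTorus x)

/-- `H^s(T³, ℝ³)`, with `‖v‖_s² = ‖v₁‖_s² + ‖v₂‖_s² + ‖v₃‖_s²`. -/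
abbrev VSobolev (s : ℝ) : Type := PiLp 2 fun _ : Fin 3 => Sobolev s

/-- The periodic vector field on `ℝ³` that corresponds to a vector field on the torus. -/
def vlift {s : ℝ} (v : VSobolev s) (x : E3) : E3 := WithLp.toLp 2 fun i => (v i).lift x

/-- All components of `v` have mean zero. -/
def MeanZero {s : ℝ} (v : VSobolev s) : Prop := ∀ i, ∫ t, (v i).toC t ∂torusMeasure = 0

/-- The divergence `∂₁v₁ + ∂₂v₂ + ∂₃v₃`, with classical derivatives. -/
def divergence {s : ℝ} (v : VSobolev s) (x : E3) : ℝ :=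
  ∑ i, fderiv ℝ (v i).lift x (EuclideanSpace.single i 1)

/-- `H^s_0`: the divergence free vector fields of class `H^s` with mean zero, with the norm of
`H^s(T³, ℝ³)`. For `s > 5/2` fields of class `H^s` are `C¹`, so that the clause on
differentiability excludes nothing. -/
def H0 (s : ℝ) : Submodule ℝ (VSobolev s) where
  carrier := {v | (∀ i, Differentiable ℝ (v i).lift) ∧ (∀ x, divergence v x = 0) ∧ MeanZero v}
  add_mem' {v w} hv hw := by
    have hl : ∀ i, ((v + w) i).lift = (v i).lift + (w i).lift := fun i => rfl
    refine ⟨fun i => by rw [hl]; exact (hv.1 i).add (hw.1 i), fun x => ?_, fun i => ?_⟩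
    · have h := congrArg₂ (· + ·) (hv.2.1 x) (hw.2.1 x)
      simp only [divergence, ← Finset.sum_add_distrib, add_zero] at h
      rw [← h]
      refine Finset.sum_congr rfl fun i _ => ?_
      rw [hl, fderiv_add (hv.1 i x) (hw.1 i x)]
      rfl
    · have h := MeasureTheory.integral_add (integrable_cont (v i).toC) (integrable_cont (w i).toC)
      rw [hv.2.2 i, hw.2.2 i, add_zero] at h
      exact h
  zero_mem' := by
    have hl : ∀ i, ((0 : VSobolev s) i).lift = fun _ => (0 : ℝ) := fun i => rfl
    refine ⟨fun i => by rw [hl]; exact differentiable_const 0, fun x => ?_, fun i => ?_⟩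
    · simp only [divergence, hl]; simp
    · exact MeasureTheory.integral_zero _ _
  smul_mem' c v hv := by
    have hl : ∀ i, ((c • v) i).lift = c • (v i).lift := fun i => rfl
    refine ⟨fun i => by rw [hl]; exact (hv.1 i).const_smul c, fun x => ?_, fun i => ?_⟩
    · have h := congrArg (fun a => c * a) (hv.2.1 x)
      simp only [divergence, Finset.mul_sum, mul_zero] at h
      rw [← h]
      refine Finset.sum_congr rfl fun i _ => ?_
      rw [hl, fderiv_const_smul (hv.1 i x)]
      rfl
    · have h := MeasureTheory.integral_const_mul (μ := torusMeasure) c (v i).toC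
      rw [hv.2.2 i, mul_zero] at h
      exact h

/-- The map `x ↦ x + w(x)` of `ℝ³`, the lift of the map of the torus with displacement `w`. -/
def displace {s : ℝ} (w : VSobolev s) (x : E3) : E3 := x + vlift w x

/-- The map `g_v(x) = x + v(x) + grad φ(x)`. -/
def gMap {s r : ℝ} (v : VSobolev s) (φ : Sobolev r) (x : E3) : E3 := x + vlift v x + ∇ φ.lift x

/-- The Jacobian determinant of `g` is identically `1`. -/
def Unimodular (g : E3 → E3) : Prop := ∀ x, (fderiv ℝ g x).det = 1

/-- The volume preserving diffeomorphisms `g` of the torus with displacement `g - Id` of class `H^s`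
and of mean zero, given by their displacements. -/
def SDiff (s : ℝ) : Set (VSobolev s) :=
  {w | Function.Bijective (displace w) ∧ Unimodular (displace w) ∧ MeanZero w}

/-- The group `D`: the component of the identity in `SDiff s`, given by displacements. -/
def D (s : ℝ) : Set (VSobolev s) := connectedComponentIn (SDiff s) 0

/-- `g - Id` is of class `H^s`, with norm less than `δ`. -/
def NearId (s δ : ℝ) (g : E3 → E3) : Prop := ∃ w : VSobolev s, g = displace w ∧ ‖w‖ < δ

end TorusChart

end

open scoped Gradient

noncomputable section

namespace TorusChart

open MeasureTheory UnitAddTorus ComplexConjugate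

/-! For a displacement `w`, `det (1 + w') = 1 + div w + N(w)`, where `N` (`detRem`) collects the
principal 2×2 minors and the determinant of `w'`. Since `H^{s-1}` is an algebra (`s - 1 > 3/2`), `N
: H^s → H^{s-1}` is a continuous polynomial map without constant or linear part. Hence `Φ(w) = w +
∇Δ⁻¹N(w)` (`straighten`) is analytic on `H^s` with `Φ(0) = 0` and `Φ'(0) = id`, and the inverse
function theorem gives an analytic local inverse.

`N(w)` has mean zero (`hat_zero_detRem`), so `div ∇Δ⁻¹N(w) = N(w)` and `div Φ(w) = div w + N(w) =
det (1 + w') - 1`. Gradients have mean zero, so `Φ(w) ∈ H0` exactly when `w` is unimodular with mean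
zero: `Φ` flattens the volume preserving displacements onto `H0`. On them `N(w) = -div w`, so `Φ(w)`
equals the Helmholtz projection `P w = w - ∇Δ⁻¹ div w`.

The chart is `G = Φ⁻¹` restricted to a ball of `H0`. From `Φ(G v) = v` one reads off `φ = -Δ⁻¹N(G
v)`. If `w = v + ∇ψ` is another small solution, then `Φ(w) = P w = v`, hence `w = G v`. The inverse
of the chart is the restriction of the bounded linear map `P`. The image of the ball is connected
and contains `0`, and small displacements give bijections, so it lies in `D`. -/

/-! ### Weights and Fourier coefficients of real functions. -/

theorem one_le_weight (n : Fin 3 → ℤ) : 1 ≤ weight n := by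
  have : 0 ≤ ∑ i, (n i : ℝ) ^ 2 := Finset.sum_nonneg fun i _ => sq_nonneg _
  unfold weight; linarith

theorem weight_neg (n : Fin 3 → ℤ) : weight (-n) = weight n := by simp [weight]

theorem sq_le_weight (n : Fin 3 → ℤ) (i : Fin 3) : (n i : ℝ) ^ 2 ≤ weight n := by
  have := Finset.single_le_sum (f := fun i => (n i : ℝ) ^ 2) (fun i _ => sq_nonneg _)
    (Finset.mem_univ i)
  unfold weight; linarith

/-- Comparison with `∑ ‖n‖ ^ (-2r)` over a lattice of rank 3, which converges because `2r > 3`; the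
sup norm satisfies `‖n‖² ≤ weight n`. -/
theorem summable_weight_rpow_neg {r : ℝ} (hr : 3 / 2 < r) :
    Summable fun n : Fin 3 → ℤ => weight n ^ (-r) := by
  let b := Pi.basisFun ℝ (Fin 3)
  let L := Submodule.span ℤ (Set.range b)
  have hrank : Module.finrank ℤ L = 3 := by
    rw [ZLattice.rank ℝ L]; simp
  have hs := ZLattice.summable_norm_rpow L (-(2 * r)) (by rw [hrank]; push_cast; linarith)
  have hmem : ∀ n : Fin 3 → ℤ, (fun i => (n i : ℝ)) ∈ L := fun n => by
    rw [Module.Basis.mem_span_iff_repr_mem]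
    intro i
    exact ⟨n i, by simp [b]⟩
  let e : (Fin 3 → ℤ) → L := fun n => ⟨_, hmem n⟩
  have he : Function.Injective e := fun m n h => by
    have h1 : (fun i => (m i : ℝ)) = fun i => (n i : ℝ) := congrArg Subtype.val h
    funext i
    exact_mod_cast congrFun h1 i
  have hs2 := hs.comp_injective he
  refine Summable.of_norm_bounded_eventually hs2 ?_
  have hfin : ({0} : Set (Fin 3 → ℤ)).Finite := Set.finite_singleton 0
  filter_upwards [hfin.compl_mem_cofinite] with n hn
  have hw := weight_pos n
  rw [Real.norm_of_nonneg (Real.rpow_nonneg hw.le _)]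
  have hn0 : 0 < ‖e n‖ := by
    rw [norm_pos_iff]
    intro h
    exact hn (he (h.trans (Subtype.ext (by ext i; simp [e]))))
  have hle : ‖e n‖ ^ 2 ≤ weight n := by
    have h1 : ‖e n‖ ≤ Real.sqrt (weight n) := by
      change ‖(fun i => (n i : ℝ))‖ ≤ _
      rw [pi_norm_le_iff_of_nonneg (Real.sqrt_nonneg _)]
      intro i
      rw [Real.norm_eq_abs]
      exact Real.abs_le_sqrt (sq_le_weight n i)
    calc ‖e n‖ ^ 2 ≤ Real.sqrt (weight n) ^ 2 := by gcongr
      _ = weight n := Real.sq_sqrt hw.le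
  change _ ≤ ‖e n‖ ^ (-(2 * r))
  rw [show -(2 * r) = 2 * (-r) by ring, Real.rpow_mul hn0.le, Real.rpow_two]
  exact Real.rpow_le_rpow_of_nonpos (by positivity) hle (by linarith)

/-- Fourier coefficients are conjugate symmetric. -/
theorem fc_neg (f : C(T3, ℝ)) (n : Fin 3 → ℤ) : fc f (-n) = conj (fc f n) := by
  rw [fc_eq_integral, fc_eq_integral, ← integral_conj]
  congr 1
  ext t
  rw [neg_neg, map_mul, Complex.conj_ofReal, mFourier_neg, Complex.conj_conj]

theorem fc_ext {f g : C(T3, ℝ)} (h : ∀ n, fc f n = fc g n) : f = g := by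
  refine sub_eq_zero.1 (fc_injective _ fun n => ?_)
  have h1 := fc_add (f - g) g n
  rw [sub_add_cancel, h n] at h1
  simpa using h1

/-- The Fourier coefficient of a complex function as a continuous linear functional. -/
def fourierFunctional (n : Fin 3 → ℤ) : C(T3, ℂ) →L[ℂ] ℂ :=
  LinearMap.mkContinuous
    { toFun := fun h => ∫ t, mFourier (-n) t * h t ∂torusMeasure
      map_add' := fun f g => by
        refine Eq.trans ?_ (integral_add (integrable_cont (mFourier (-n) * f))
          (integrable_cont (mFourier (-n) * g)))
        congr 1; ext t; simp [mul_add]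
      map_smul' := fun c f => by
        simp only [RingHom.id_apply]
        rw [smul_eq_mul, ← integral_const_mul]
        congr 1; ext t; simp [mul_left_comm] }
    (torusMeasure.real Set.univ) fun h => by
      refine (norm_integral_le_of_norm_le_const (C := ‖h‖) (Filter.Eventually.of_forall
        fun t => ?_)).trans (le_of_eq (mul_comm _ _))
      rw [norm_mul]
      have h1 := (mFourier (-n)).norm_coe_le_norm t
      rw [mFourier_norm] at h1
      calc _ ≤ 1 * ‖h‖ := mul_le_mul h1 (h.norm_coe_le_norm t) (norm_nonneg _) zero_le_one
        _ = ‖h‖ := one_mul _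

theorem fourierFunctional_cplx (f : C(T3, ℝ)) (n : Fin 3 → ℤ) :
    fourierFunctional n (cplx f) = fc f n := rfl

theorem fourierFunctional_mFourier (m n : Fin 3 → ℤ) :
    fourierFunctional n (mFourier m) = if m = n then 1 else 0 := by
  have h : mFourierCoeff (mFourier m) n = if m = n then 1 else 0 := by
    rw [← mFourierCoeff_toLp, ← mFourierBasis_repr]
    have := mFourierBasis.repr_self m
    rw [coe_mFourierBasis] at this
    rw [this, lp.single_apply, Pi.single_apply]
    simp [eq_comm]
  exact h

theorem fourierFunctional_mFourier_mul (m n : Fin 3 → ℤ) (g : C(T3, ℂ)) :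
    fourierFunctional n (mFourier m * g) = fourierFunctional (n - m) g := by
  change ∫ t, mFourier (-n) t * (mFourier m * g) t ∂torusMeasure =
    ∫ t, mFourier (-(n - m)) t * g t ∂torusMeasure
  congr 1
  ext t
  rw [show -(n - m) = -n + m by abel, mFourier_add, ContinuousMap.mul_apply, mul_assoc]

/-- A conjugate symmetric summable family is the family of Fourier coefficients of a real
continuous function. -/
theorem exists_fc_eq {c : (Fin 3 → ℤ) → ℂ} (hc : Summable fun n => ‖c n‖)
    (hconj : ∀ n, c (-n) = conj (c n)) : ∃ f : C(T3, ℝ), ∀ n, fc f n = c n := by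
  have hsum : Summable fun n => c n • (mFourier n : C(T3, ℂ)) := by
    refine .of_norm ?_
    simpa only [norm_smul, mFourier_norm, mul_one] using hc
  obtain ⟨g, hg⟩ := hsum
  -- Conjugating the series amounts to reindexing it by `n ↦ -n`.
  have hreal : ∀ t, conj (g t) = g t := fun t => by
    have h1 : HasSum (fun n => c n • (mFourier n : C(T3, ℂ)) t) (g t) :=
      (ContinuousMap.evalCLM ℂ t).hasSum hg
    have h2 := (Complex.hasSum_conj' (f := fun n => conj (c n • (mFourier n : C(T3, ℂ)) t))
      (x := conj (g t))).1 (by simpa using h1)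
    have h3 := (Equiv.neg (Fin 3 → ℤ)).hasSum_iff.2 h2
    refine (h3.unique (h1.congr_fun fun n => ?_))
    simp only [Function.comp, Equiv.neg_apply, smul_eq_mul, map_mul, hconj, mFourier_neg,
      Complex.conj_conj]
  refine ⟨⟨fun t => (g t).re, by fun_prop⟩, fun n => ?_⟩
  have hg' : cplx ⟨fun t => (g t).re, by fun_prop⟩ = g := by
    ext t
    exact Complex.conj_eq_iff_re.1 (hreal t)
  rw [← fourierFunctional_cplx, hg']
  have h := (fourierFunctional n).hasSum hg
  refine h.unique ?_
  simp only [map_smul, fourierFunctional_mFourier]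
  convert hasSum_ite_eq n (c n) using 2 with m
  split_ifs with hm
  · simp [hm]
  · simp

/-- The Cauchy–Schwarz inequality for series. -/
theorem summable_mul_and_sq_tsum_le {ι : Type*} {x y : ι → ℝ}
    (hx0 : ∀ i, 0 ≤ x i) (hy0 : ∀ i, 0 ≤ y i) (hx : Summable fun i => x i ^ 2)
    (hy : Summable fun i => y i ^ 2) :
    Summable (fun i => x i * y i) ∧
      (∑' i, x i * y i) ^ 2 ≤ (∑' i, x i ^ 2) * ∑' i, y i ^ 2 := by
  have h := Real.summable_and_inner_le_Lp_mul_Lq_tsum_of_nonneg Real.HolderConjugate.two_two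
    hx0 hy0 (by simpa only [Real.rpow_two] using hx) (by simpa only [Real.rpow_two] using hy)
  simp only [Real.rpow_two, ← Real.sqrt_eq_rpow] at h
  refine ⟨h.1, ?_⟩
  have hX : 0 ≤ ∑' i, x i ^ 2 := tsum_nonneg fun i => sq_nonneg _
  have hY : 0 ≤ ∑' i, y i ^ 2 := tsum_nonneg fun i => sq_nonneg _
  calc (∑' i, x i * y i) ^ 2 ≤ (Real.sqrt (∑' i, x i ^ 2) * Real.sqrt (∑' i, y i ^ 2)) ^ 2 := by
        gcongr
        · exact tsum_nonneg fun i => mul_nonneg (hx0 i) (hy0 i)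
        · exact h.2
    _ = _ := by rw [mul_pow, Real.sq_sqrt hX, Real.sq_sqrt hY]

/-! ### Embedding, completeness and Fourier multipliers. -/

namespace Sobolev

variable {r : ℝ}

theorem ext_fc {f g : Sobolev r} (h : ∀ n, fc f.toC n = fc g.toC n) : f = g :=
  Subtype.ext (fc_ext h)

theorem summable_sq (f : Sobolev r) :
    Summable fun n : Fin 3 → ℤ => weight n ^ r * ‖fc f.toC n‖ ^ 2 := f.2

/-- The constant of the embedding of `H^r` in the functions with summable Fourier series. -/
def embConst (r : ℝ) : ℝ := Real.sqrt (∑' n : Fin 3 → ℤ, weight n ^ (-r))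

theorem embConst_nonneg (r : ℝ) : 0 ≤ embConst r := Real.sqrt_nonneg _

/-- Cauchy–Schwarz for `‖c n‖ = weight n ^ (-r/2) * (weight n ^ (r/2) * ‖c n‖)`. -/
theorem summable_and_tsum_le (hr : 3 / 2 < r) {c : (Fin 3 → ℤ) → ℂ}
    (hc : Summable fun n => weight n ^ r * ‖c n‖ ^ 2) :
    Summable (fun n => ‖c n‖) ∧
      ∑' n, ‖c n‖ ≤ embConst r * Real.sqrt (∑' n, weight n ^ r * ‖c n‖ ^ 2) := by
  have h1 : ∀ n : Fin 3 → ℤ, (weight n ^ (-r / 2)) ^ 2 = weight n ^ (-r) := fun n => by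
    rw [← Real.rpow_natCast, ← Real.rpow_mul (weight_pos n).le]; congr 1; push_cast; ring
  have h2 : ∀ n : Fin 3 → ℤ, (weight n ^ (r / 2) * ‖c n‖) ^ 2 = weight n ^ r * ‖c n‖ ^ 2 :=
    fun n => by
      rw [mul_pow, ← Real.rpow_natCast, ← Real.rpow_mul (weight_pos n).le]
      congr 2; push_cast; ring
  have h3 : ∀ n : Fin 3 → ℤ, weight n ^ (-r / 2) * (weight n ^ (r / 2) * ‖c n‖) = ‖c n‖ :=
    fun n => by
      rw [← mul_assoc, ← Real.rpow_add (weight_pos n), show -r / 2 + r / 2 = 0 by ring,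
        Real.rpow_zero, one_mul]
  have h := summable_mul_and_sq_tsum_le
    (x := fun n : Fin 3 → ℤ => weight n ^ (-r / 2))
    (y := fun n => weight n ^ (r / 2) * ‖c n‖)
    (fun n => Real.rpow_nonneg (weight_pos n).le _)
    (fun n => mul_nonneg (Real.rpow_nonneg (weight_pos n).le _) (norm_nonneg _))
    (by simpa only [h1] using summable_weight_rpow_neg hr) (by simpa only [h2] using hc)
  simp only [h1, h2, h3] at h
  refine ⟨h.1, ?_⟩
  rw [embConst, ← Real.sqrt_mul (tsum_nonneg fun n => Real.rpow_nonneg (weight_pos n).le _)]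
  exact Real.le_sqrt_of_sq_le h.2

theorem summable_fc (hr : 3 / 2 < r) (f : Sobolev r) : Summable fun n => ‖fc f.toC n‖ :=
  (summable_and_tsum_le hr f.summable_sq).1

theorem norm_eq_sqrt (f : Sobolev r) :
    ‖f‖ = Real.sqrt (∑' n : Fin 3 → ℤ, weight n ^ r * ‖fc f.toC n‖ ^ 2) := by
  rw [← norm_sq, Real.sqrt_sq (norm_nonneg _)]

theorem tsum_fc_le (hr : 3 / 2 < r) (f : Sobolev r) :
    ∑' n, ‖fc f.toC n‖ ≤ embConst r * ‖f‖ := by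
  rw [norm_eq_sqrt]
  exact (summable_and_tsum_le hr f.summable_sq).2

theorem norm_le_of_sq_le {f : Sobolev r} {B : ℝ} (hB : 0 ≤ B)
    (h : ∑' n : Fin 3 → ℤ, weight n ^ r * ‖fc f.toC n‖ ^ 2 ≤ B ^ 2) : ‖f‖ ≤ B :=
  abs_le_of_sq_le_sq' (by rwa [norm_sq]) hB |>.2

/-- Every conjugate symmetric family of finite Sobolev norm comes from an element of `H^r`. -/
theorem exists_of_coeff (hr : 3 / 2 < r) {c : (Fin 3 → ℤ) → ℂ}
    (hc : Summable fun n => weight n ^ r * ‖c n‖ ^ 2) (hconj : ∀ n, c (-n) = conj (c n)) :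
    ∃ f : Sobolev r, ∀ n, fc f.toC n = c n := by
  obtain ⟨f, hf⟩ := exists_fc_eq (summable_and_tsum_le hr hc).1 hconj
  refine ⟨⟨f, ?_⟩, hf⟩
  change Summable _
  simpa only [hf] using hc

theorem hasSum_fourier (hr : 3 / 2 < r) (f : Sobolev r) :
    HasSum (fun n => fc f.toC n • (mFourier n : C(T3, ℂ))) (cplx f.toC) :=
  hasSum_mFourier_series_of_summable (f := cplx f.toC) (summable_fc hr f).of_norm

theorem toC_add (f g : Sobolev r) : (f + g).toC = f.toC + g.toC := map_add _ _ _

/-- Fourier coefficients as a linear map on `H^r`. -/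
def hat (n : Fin 3 → ℤ) : Sobolev r →ₗ[ℝ] ℂ where
  toFun f := fc f.toC n
  map_add' _ _ := fc_add _ _ n
  map_smul' c _ := fc_smul c _ n

theorem hat_apply (n : Fin 3 → ℤ) (f : Sobolev r) : hat n f = fc f.toC n := rfl

theorem ext_hat {f g : Sobolev r} (h : ∀ n, hat n f = hat n g) : f = g := ext_fc h

/-- The weighted Fourier transform is an isometry onto the conjugate symmetric sequences, which are
closed in `ℓ²`. Completeness is what the inverse function theorem requires. -/
theorem completeSpace (hr : 3 / 2 < r) : CompleteSpace (Sobolev r) := by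
  let T := coeffs r
  have hT : Isometry T := AddMonoidHomClass.isometry_of_norm T fun f => rfl
  have hrange : Set.range T =
      {a : lp (fun _ : Fin 3 → ℤ => ℂ) 2 | ∀ n, a (-n) = conj (a n)} := by
    ext a
    constructor
    · rintro ⟨f, rfl⟩ n
      change wfc r f.toC (-n) = conj (wfc r f.toC n)
      simp [wfc, weight_neg, fc_neg]
    · intro ha
      have hpos : ∀ n : Fin 3 → ℤ, 0 < weight n ^ (r / 2) :=
        fun n => Real.rpow_pos_of_pos (weight_pos n) _
      obtain ⟨f, hf⟩ := exists_of_coeff hr (c := fun n => ((weight n ^ (r / 2))⁻¹ : ℝ) • a n)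
        (by
          have h := (memℓp_gen_iff (p := 2) (by norm_num)).1 (lp.memℓp a)
          simp only [ENNReal.toReal_ofNat, Real.rpow_ofNat] at h
          refine h.congr fun n => ?_
          have e : weight n ^ r = (weight n ^ (r / 2)) ^ 2 := by
            rw [← Real.rpow_natCast, ← Real.rpow_mul (weight_pos n).le]; norm_num
          rw [norm_smul, mul_pow, norm_inv, Real.norm_of_nonneg (hpos n).le, e, ← mul_assoc,
            ← mul_pow, mul_inv_cancel₀ (hpos n).ne', one_pow, one_mul])
        (fun n => by simp [weight_neg, ha n])
      refine ⟨f, ?_⟩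
      ext n
      change wfc r f.toC n = a n
      rw [wfc, hf, smul_smul, mul_inv_cancel₀ (hpos n).ne', one_smul]
  have hclosed : IsClosed (Set.range T) := by
    rw [hrange, Set.ofPred_forall]
    refine isClosed_iInter fun n => ?_
    have hc : ∀ n : Fin 3 → ℤ, Continuous fun a : lp (fun _ : Fin 3 → ℤ => ℂ) 2 => a n :=
      fun n => (lp.evalCLM ℂ (fun _ : Fin 3 → ℤ => ℂ) 2 n).continuous
    exact isClosed_eq (hc _) (Complex.continuous_conj.comp (hc _))
  rw [completeSpace_iff_isComplete_range hT.isUniformInducing]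
  exact hclosed.isComplete

/-- A Fourier multiplier of order at most `a - b` is bounded from `H^a` to `H^b`. -/
theorem exists_multiplier {a b : ℝ} (hb : 3 / 2 < b) {m : (Fin 3 → ℤ) → ℂ}
    (hconj : ∀ n, m (-n) = conj (m n)) {C : ℝ}
    (hm : ∀ n, ‖m n‖ ^ 2 * weight n ^ b ≤ C * weight n ^ a) :
    ∃ T : Sobolev a →L[ℝ] Sobolev b, ∀ f n, hat n (T f) = m n * hat n f := by
  -- The bound at `n = 0`, where the weight is `1`, reads `‖m 0‖² ≤ C`.
  have hC : 0 ≤ C := by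
    have h := hm 0
    simp only [weight, Pi.zero_apply, Int.cast_zero, ne_eq, OfNat.ofNat_ne_zero,
      not_false_eq_true, zero_pow, Finset.sum_const_zero, add_zero, Real.one_rpow, mul_one] at h
    exact (sq_nonneg _).trans h
  have hle : ∀ (f : Sobolev a) n, weight n ^ b * ‖m n * fc f.toC n‖ ^ 2 ≤
      C * (weight n ^ a * ‖fc f.toC n‖ ^ 2) := fun f n => by
    have := mul_le_mul_of_nonneg_right (hm n) (sq_nonneg ‖fc f.toC n‖)
    rw [norm_mul]
    linarith
  have hnn : ∀ (f : Sobolev a) n, 0 ≤ weight n ^ b * ‖m n * fc f.toC n‖ ^ 2 := fun f n =>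
    mul_nonneg (Real.rpow_nonneg (weight_pos n).le _) (sq_nonneg _)
  have hsum : ∀ f : Sobolev a, Summable fun n => weight n ^ b * ‖m n * fc f.toC n‖ ^ 2 :=
    fun f => .of_nonneg_of_le (hnn f) (hle f) (f.summable_sq.mul_left C)
  have hex : ∀ f : Sobolev a, ∃ g : Sobolev b, ∀ n, fc g.toC n = m n * fc f.toC n := fun f =>
    exists_of_coeff hb (hsum f) fun n => by rw [hconj, fc_neg, map_mul]
  choose T hT using hex
  let T' : Sobolev a →ₗ[ℝ] Sobolev b :=
    { toFun := T
      map_add' := fun f g => ext_hat fun n => by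
        rw [map_add]; simp only [hat_apply, hT]; rw [← mul_add, toC_add, fc_add]
      map_smul' := fun c f => ext_hat fun n => by
        rw [RingHom.id_apply, map_smul]; simp only [hat_apply, hT, map_smul, fc_smul]
        rw [mul_smul_comm] }
  refine ⟨T'.mkContinuous (Real.sqrt C) fun f => ?_, hT⟩
  refine norm_le_of_sq_le (by positivity) ?_
  change ∑' n, weight n ^ b * ‖fc (T f).toC n‖ ^ 2 ≤ _
  rw [mul_pow, Real.sq_sqrt hC, norm_sq, ← tsum_mul_left]
  simp only [hT]
  exact (hsum f).tsum_le_tsum (hle f) (f.summable_sq.mul_left C)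

end Sobolev

/-! ### The algebra property. -/

/-- Young's inequality for the convolution of a summable and a square summable family. -/
theorem summable_and_tsum_conv_sq_le {ι : Type*} [AddCommGroup ι] {a b : ι → ℝ}
    (ha0 : ∀ i, 0 ≤ a i) (hb0 : ∀ i, 0 ≤ b i) (ha : Summable a)
    (hb : Summable fun i => b i ^ 2) :
    (∀ n, Summable fun m => a m * b (n - m)) ∧
    Summable (fun n => (∑' m, a m * b (n - m)) ^ 2) ∧
      ∑' n, (∑' m, a m * b (n - m)) ^ 2 ≤ (∑' m, a m) ^ 2 * ∑' n, b n ^ 2 := by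
  have hS : Summable fun p : ι × ι => a p.1 * b p.2 ^ 2 :=
    ha.mul_of_nonneg hb ha0 fun i => sq_nonneg _
  -- The shear `(n, m) ↦ (m, n - m)` turns the double sum of the convolution into a product of sums.
  let e : ι × ι ≃ ι × ι :=
    { toFun := fun p => (p.2, p.1 - p.2)
      invFun := fun p => (p.1 + p.2, p.1)
      left_inv := fun p => by simp
      right_inv := fun p => by simp }
  have hS' : Summable fun p : ι × ι => a p.2 * b (p.1 - p.2) ^ 2 := e.summable_iff.2 hS
  have htot : ∑' n, ∑' m, a m * b (n - m) ^ 2 = (∑' m, a m) * ∑' n, b n ^ 2 := by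
    rw [← hS'.tsum_prod, ha.tsum_mul_tsum hb hS]
    exact e.tsum_eq fun p : ι × ι => a p.1 * b p.2 ^ 2
  have hfib : ∀ n, Summable fun m => a m * b (n - m) ^ 2 := fun n => hS'.prod_factor n
  have hcs : ∀ n, Summable (fun m => a m * b (n - m)) ∧
      (∑' m, a m * b (n - m)) ^ 2 ≤ (∑' m, a m) * ∑' m, a m * b (n - m) ^ 2 := fun n => by
    -- Cauchy–Schwarz with the splitting `a * b = √a * (√a * b)`.
    have e1 : ∀ m, Real.sqrt (a m) ^ 2 = a m := fun m => Real.sq_sqrt (ha0 m)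
    have e2 : ∀ m, (Real.sqrt (a m) * b (n - m)) ^ 2 = a m * b (n - m) ^ 2 := fun m => by
      rw [mul_pow, e1]
    have e3 : ∀ m, Real.sqrt (a m) * (Real.sqrt (a m) * b (n - m)) = a m * b (n - m) :=
      fun m => by rw [← mul_assoc, ← sq, e1]
    have h := summable_mul_and_sq_tsum_le (x := fun m => Real.sqrt (a m))
      (y := fun m => Real.sqrt (a m) * b (n - m)) (fun m => Real.sqrt_nonneg _)
      (fun m => mul_nonneg (Real.sqrt_nonneg _) (hb0 _)) (by simpa only [e1] using ha)
      (by simpa only [e2] using hfib n)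
    simpa only [e1, e2, e3] using h
  have hright : Summable fun n => (∑' m, a m) * ∑' m, a m * b (n - m) ^ 2 := hS'.prod.mul_left _
  have hsq : Summable fun n => (∑' m, a m * b (n - m)) ^ 2 :=
    .of_nonneg_of_le (fun n => sq_nonneg _) (fun n => (hcs n).2) hright
  refine ⟨fun n => (hcs n).1, hsq, (hsq.tsum_le_tsum (fun n => (hcs n).2) hright).trans ?_⟩
  rw [tsum_mul_left, htot, sq, mul_assoc]

theorem weight_le_two_mul (n m : Fin 3 → ℤ) : weight n ≤ 2 * (weight m + weight (n - m)) := by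
  have h : ∑ i, (n i : ℝ) ^ 2 ≤
      2 * (∑ i, (m i : ℝ) ^ 2 + ∑ i, (((n - m) i : ℤ) : ℝ) ^ 2) := by
    rw [← Finset.sum_add_distrib, Finset.mul_sum]
    refine Finset.sum_le_sum fun i _ => ?_
    rw [Pi.sub_apply]
    push_cast
    nlinarith [sq_nonneg ((m i : ℝ) - (n i - m i))]
  unfold weight
  linarith

/-- The larger of the two weights alone dominates, up to the factor 4. In a convolution this lets
the weight fall on a single factor at a time. -/
theorem weight_rpow_le {p : ℝ} (hp : 0 ≤ p) (n m : Fin 3 → ℤ) :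
    weight n ^ p ≤ 4 ^ p * (weight m ^ p + weight (n - m) ^ p) := by
  have h1 := weight_le_two_mul n m
  have hm := weight_pos m
  have hk := weight_pos (n - m)
  have hmp : 0 ≤ weight m ^ p := Real.rpow_nonneg hm.le _
  have hkp : 0 ≤ weight (n - m) ^ p := Real.rpow_nonneg hk.le _
  rw [mul_add, ← Real.mul_rpow (by norm_num) hm.le, ← Real.mul_rpow (by norm_num) hk.le]
  rcases le_total (weight m) (weight (n - m)) with h | h
  · have := Real.rpow_le_rpow (weight_pos n).le (show weight n ≤ 4 * weight (n - m) by linarith) hp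
    have h0 : 0 ≤ (4 * weight m) ^ p := Real.rpow_nonneg (by linarith) _
    linarith
  · have := Real.rpow_le_rpow (weight_pos n).le (show weight n ≤ 4 * weight m by linarith) hp
    have h0 : 0 ≤ (4 * weight (n - m)) ^ p := Real.rpow_nonneg (by linarith) _
    linarith

namespace Sobolev

variable {r : ℝ}

/-- The Fourier coefficients of a product are given by convolution. -/
theorem hasSum_fc_mul (hr : 3 / 2 < r) (f : Sobolev r) (g : C(T3, ℝ)) (n : Fin 3 → ℤ) :
    HasSum (fun m => fc f.toC m * fc g (n - m)) (fc (f.toC * g) n) := by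
  have h := (fourierFunctional n).hasSum ((hasSum_fourier hr f).mul_right (cplx g))
  have e : cplx f.toC * cplx g = cplx (f.toC * g) := by ext t; simp [cplx]
  rw [e, fourierFunctional_cplx] at h
  refine h.congr_fun fun m => ?_
  rw [smul_mul_assoc, map_smul, fourierFunctional_mFourier_mul, fourierFunctional_cplx,
    smul_eq_mul]

/-- By `weight_rpow_le` the weighted convolution is at most a multiple of `X f g + X g f`, each a
convolution of an `ℓ¹` family (the unweighted factor) with an `ℓ²` family (the weighted one);
Young's inequality applies to both. -/
theorem memSobolev_mul_and_le (hr : 3 / 2 < r) (f g : Sobolev r) :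
    MemSobolev r (f.toC * g.toC) ∧
      ∑' n : Fin 3 → ℤ, weight n ^ r * ‖fc (f.toC * g.toC) n‖ ^ 2 ≤
        (2 * 4 ^ (r / 2) * embConst r * ‖f‖ * ‖g‖) ^ 2 := by
  have hr2 : 0 ≤ r / 2 := by linarith
  have hwp : ∀ n : Fin 3 → ℤ, 0 ≤ weight n ^ (r / 2) :=
    fun n => Real.rpow_nonneg (weight_pos n).le _
  have hnn : ∀ (f : Sobolev r) n, 0 ≤ weight n ^ (r / 2) * ‖fc f.toC n‖ :=
    fun f n => mul_nonneg (hwp n) (norm_nonneg _)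
  have hsq : ∀ (n : Fin 3 → ℤ) (x : ℝ),
      (weight n ^ (r / 2) * x) ^ 2 = weight n ^ r * x ^ 2 := fun n x => by
    rw [mul_pow, ← Real.rpow_natCast, ← Real.rpow_mul (weight_pos n).le]
    congr 2; push_cast; ring
  have young : ∀ f g : Sobolev r, _ := fun f g =>
    summable_and_tsum_conv_sq_le (a := fun n => ‖fc f.toC n‖)
      (b := fun n => weight n ^ (r / 2) * ‖fc g.toC n‖) (fun n => norm_nonneg (fc f.toC n)) (hnn g)
      (summable_fc hr f) (by simpa only [hsq] using g.summable_sq)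
  simp only [hsq, ← norm_sq] at young
  let X : Sobolev r → Sobolev r → (Fin 3 → ℤ) → ℝ := fun f g n =>
    ∑' m, ‖fc f.toC m‖ * (weight (n - m) ^ (r / 2) * ‖fc g.toC (n - m)‖)
  have hX : ∀ f g : Sobolev r, ∑' n, X f g n ^ 2 ≤ (embConst r * ‖f‖ * ‖g‖) ^ 2 := fun f g => by
    refine (young f g).2.2.trans ?_
    rw [mul_pow]
    gcongr
    exact tsum_fc_le hr f
  have hpt : ∀ n, weight n ^ (r / 2) * ‖fc (f.toC * g.toC) n‖ ≤
      4 ^ (r / 2) * (X f g n + X g f n) := fun n => by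
    have hs2 : HasSum (fun m => weight m ^ (r / 2) * ‖fc f.toC m‖ * ‖fc g.toC (n - m)‖)
        (X g f n) := by
      have h := ((young g f).1 n).hasSum
      rw [← (Equiv.subLeft n).hasSum_iff] at h
      refine h.congr_fun fun m => ?_
      simp only [Function.comp, Equiv.subLeft_apply, sub_sub_cancel]
      ring
    have hs := (((young f g).1 n).hasSum.add hs2).mul_left (4 ^ (r / 2) : ℝ)
    have hc := (hasSum_fc_mul hr f g.toC n).mul_left ((weight n ^ (r / 2) : ℝ) : ℂ)
    have hle := tsum_of_norm_bounded hs
      (f := fun m => ((weight n ^ (r / 2) : ℝ) : ℂ) * (fc f.toC m * fc g.toC (n - m)))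
      fun m => by
        rw [norm_mul, norm_mul, Complex.norm_real, Real.norm_of_nonneg (hwp n)]
        have := mul_le_mul_of_nonneg_right (weight_rpow_le hr2 n m)
          (mul_nonneg (norm_nonneg (fc f.toC m)) (norm_nonneg (fc g.toC (n - m))))
        refine this.trans (le_of_eq ?_)
        ring
    rw [hc.tsum_eq, norm_mul, Complex.norm_real, Real.norm_of_nonneg (hwp n), add_comm] at hle
    rw [add_comm]
    convert hle using 1
  have hpt2 : ∀ n, weight n ^ r * ‖fc (f.toC * g.toC) n‖ ^ 2 ≤
      2 * (4 ^ (r / 2)) ^ 2 * (X f g n ^ 2 + X g f n ^ 2) := fun n => by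
    rw [← hsq]
    calc _ ≤ (4 ^ (r / 2) * (X f g n + X g f n)) ^ 2 :=
          pow_le_pow_left₀ (mul_nonneg (hwp n) (norm_nonneg _)) (hpt n) 2
      _ ≤ _ := by
          rw [mul_pow, mul_comm (2 : ℝ), mul_assoc]
          gcongr
          nlinarith [sq_nonneg (X f g n - X g f n)]
  have hsum := ((young f g).2.1.add (young g f).2.1).mul_left (2 * (4 ^ (r / 2) : ℝ) ^ 2)
  have hmem : Summable fun n : Fin 3 → ℤ => weight n ^ r * ‖fc (f.toC * g.toC) n‖ ^ 2 :=
    .of_nonneg_of_le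
      (fun n => mul_nonneg (Real.rpow_nonneg (weight_pos n).le _) (sq_nonneg _)) hpt2 hsum
  refine ⟨hmem, (hmem.tsum_le_tsum hpt2 hsum).trans ?_⟩
  rw [tsum_mul_left, (young f g).2.1.tsum_add (young g f).2.1]
  calc _ ≤ 2 * (4 ^ (r / 2) : ℝ) ^ 2 *
        ((embConst r * ‖f‖ * ‖g‖) ^ 2 + (embConst r * ‖g‖ * ‖f‖) ^ 2) := by
        gcongr
        · exact hX f g
        · exact hX g f
    _ = _ := by ring

/-- `H^r` is an algebra for `r > 3/2`: multiplication as a bounded bilinear map. -/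
def mul (hr : 3 / 2 < r) : Sobolev r →L[ℝ] Sobolev r →L[ℝ] Sobolev r :=
  LinearMap.mkContinuous₂
    (LinearMap.mk₂ ℝ (fun f g => (⟨f.toC * g.toC, (memSobolev_mul_and_le hr f g).1⟩ : Sobolev r))
      (fun f f' g => Subtype.ext (add_mul f.toC f'.toC g.toC))
      (fun c f g => Subtype.ext (smul_mul_assoc c f.toC g.toC))
      (fun f g g' => Subtype.ext (mul_add f.toC g.toC g'.toC))
      (fun c f g => Subtype.ext (mul_smul_comm c f.toC g.toC)))
    (2 * 4 ^ (r / 2) * embConst r) fun f g =>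
      norm_le_of_sq_le (by have := embConst_nonneg r; positivity) (memSobolev_mul_and_le hr f g).2

theorem hasSum_hat_mul (hr : 3 / 2 < r) (f g : Sobolev r) (n : Fin 3 → ℤ) :
    HasSum (fun m => hat m f * hat (n - m) g) (hat n (mul hr f g)) :=
  hasSum_fc_mul hr f g.toC n

end Sobolev

/-! ### Periodic lifts and differential operators as Fourier multipliers. -/

theorem surjective_toTorus : Function.Surjective toTorus := fun t => by
  choose y hy using fun i => QuotientAddGroup.mk_surjective (t i)
  refine ⟨WithLp.toLp 2 fun i => 2 * Real.pi * y i, ?_⟩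
  funext i
  rw [← hy i]
  change ((2 * Real.pi * y i / (2 * Real.pi) : ℝ) : UnitAddCircle) = _
  rw [mul_div_cancel_left₀ _ (by positivity)]

/-- The phase `x ↦ n · x`. -/
def phase (n : Fin 3 → ℤ) : E3 →L[ℝ] ℝ :=
  ∑ i, (n i : ℝ) • (EuclideanSpace.proj i : E3 →L[ℝ] ℝ)

theorem phase_apply (n : Fin 3 → ℤ) (x : E3) : phase n x = ∑ i, (n i : ℝ) * x i := by
  simp [phase]

theorem norm_proj_le (i : Fin 3) : ‖(EuclideanSpace.proj i : E3 →L[ℝ] ℝ)‖ ≤ 1 :=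
  ContinuousLinearMap.opNorm_le_bound _ zero_le_one fun x => by
    rw [one_mul]; exact PiLp.norm_apply_le x i

theorem norm_phase_le (n : Fin 3 → ℤ) : ‖phase n‖ ≤ ∑ i, |(n i : ℝ)| := by
  refine (norm_sum_le _ _).trans (Finset.sum_le_sum fun i _ => ?_)
  rw [norm_smul, Real.norm_eq_abs]
  exact mul_le_of_le_one_right (abs_nonneg _) (norm_proj_le i)

theorem mFourier_toTorus (n : Fin 3 → ℤ) (x : E3) :
    mFourier n (toTorus x) = Complex.exp (Complex.I * phase n x) := by
  change ∏ i, fourier (n i) ((x i / (2 * Real.pi) : ℝ) : UnitAddCircle) = _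
  simp only [fourier_coe_apply]
  rw [← Complex.exp_sum, phase_apply]
  congr 1
  push_cast
  rw [Finset.mul_sum]
  refine Finset.sum_congr rfl fun i _ => ?_
  have : (Real.pi : ℂ) ≠ 0 := by exact_mod_cast Real.pi_ne_zero
  field_simp

namespace Sobolev

variable {a b : ℝ}

theorem lift_add (f g : Sobolev a) (x : E3) : (f + g).lift x = f.lift x + g.lift x := rfl

theorem lift_ext {f : Sobolev a} {g : Sobolev b} (h : ∀ x, f.lift x = g.lift x) :
    f.toC = g.toC := by
  ext t
  obtain ⟨x, rfl⟩ := surjective_toTorus t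
  exact h x

theorem hasSum_lift (ha : 3 / 2 < a) (f : Sobolev a) (x : E3) :
    HasSum (fun n => hat n f * Complex.exp (Complex.I * phase n x)) (f.lift x : ℂ) := by
  have h := (ContinuousMap.evalCLM ℂ (toTorus x)).hasSum (hasSum_fourier ha f)
  refine h.congr_fun fun n => ?_
  rw [← mFourier_toTorus]
  rfl

theorem norm_exp_phase (n : Fin 3 → ℤ) (x : E3) :
    ‖Complex.exp (Complex.I * phase n x)‖ = 1 := by
  rw [mul_comm]; exact Complex.norm_exp_ofReal_mul_I _

theorem abs_lift_le (ha : 3 / 2 < a) (f : Sobolev a) (x : E3) :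
    |f.lift x| ≤ embConst a * ‖f‖ := by
  have h := hasSum_lift ha f x
  have h2 := tsum_of_norm_bounded (summable_fc ha f).hasSum
    (f := fun n => hat n f * Complex.exp (Complex.I * phase n x)) fun n => by
      rw [norm_mul, norm_exp_phase, mul_one, hat_apply]
  rw [h.tsum_eq, Complex.norm_real, Real.norm_eq_abs] at h2
  exact h2.trans (tsum_fc_le ha f)

theorem exists_partialDeriv (j : Fin 3) (hb : 3 / 2 < b) (hab : b + 1 ≤ a) :
    ∃ T : Sobolev a →L[ℝ] Sobolev b, ∀ f n, hat n (T f) = Complex.I * n j * hat n f := by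
  refine exists_multiplier hb (C := 1) (fun n => ?_) fun n => ?_
  · simp
  · rw [norm_mul, Complex.norm_I, one_mul, Complex.norm_intCast, sq_abs, one_mul]
    calc _ ≤ weight n * weight n ^ b :=
          mul_le_mul_of_nonneg_right (sq_le_weight n j) (Real.rpow_nonneg (weight_pos n).le _)
      _ = weight n ^ (b + 1) := by rw [Real.rpow_add_one (weight_pos n).ne', mul_comm]
      _ ≤ weight n ^ a := Real.rpow_le_rpow_of_exponent_le (one_le_weight n) hab

/-- The partial derivative `∂_j : H^a → H^b`, `b ≤ a - 1`. -/
def partialDeriv (j : Fin 3) (hb : 3 / 2 < b) (hab : b + 1 ≤ a) : Sobolev a →L[ℝ] Sobolev b :=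
  (exists_partialDeriv j hb hab).choose

theorem hat_partialDeriv (j : Fin 3) (hb : 3 / 2 < b) (hab : b + 1 ≤ a) (f : Sobolev a)
    (n : Fin 3 → ℤ) : hat n (partialDeriv j hb hab f) = Complex.I * n j * hat n f :=
  (exists_partialDeriv j hb hab).choose_spec f n

/-- The squared length `|n|²`. -/
def normSq (n : Fin 3 → ℤ) : ℝ := ∑ i, (n i : ℝ) ^ 2

theorem one_le_normSq {n : Fin 3 → ℤ} (hn : n ≠ 0) : 1 ≤ normSq n := by
  obtain ⟨i, hi⟩ := Function.ne_iff.1 hn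
  have h1 : (1 : ℝ) ≤ (n i : ℝ) ^ 2 := by
    have : (1 : ℤ) ≤ n i ^ 2 := by
      have : 0 < n i ^ 2 := by have : n i ≠ 0 := hi; positivity
      omega
    exact_mod_cast this
  exact h1.trans (Finset.single_le_sum (f := fun i => (n i : ℝ) ^ 2) (fun i _ => sq_nonneg _)
    (Finset.mem_univ i))

theorem exists_invLaplacian (hb : 3 / 2 < b) (hab : b ≤ a + 2) :
    ∃ T : Sobolev a →L[ℝ] Sobolev b, ∀ f n, hat n (T f) = -((normSq n : ℂ))⁻¹ * hat n f := by
  refine exists_multiplier hb (C := 4) (fun n => ?_) fun n => ?_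
  · simp [normSq]
  · rw [norm_neg, norm_inv, Complex.norm_real, Real.norm_eq_abs]
    have hwa : 0 ≤ weight n ^ a := Real.rpow_nonneg (weight_pos n).le _
    by_cases hn : n = 0
    -- The symbol at frequency zero is `0⁻¹ = 0`; this is why constants are killed.
    · have : normSq n = 0 := by simp [hn, normSq]
      rw [this]; simp [hwa]
    · have hS := one_le_normSq hn
      have hw : weight n ≤ 2 * normSq n := by
        have : weight n = 1 + normSq n := rfl
        linarith
      have hw0 := weight_pos n
      rw [abs_of_pos (by linarith), inv_pow, inv_mul_le_iff₀ (by positivity)]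
      calc weight n ^ b ≤ weight n ^ (a + 2) :=
            Real.rpow_le_rpow_of_exponent_le (one_le_weight n) hab
        _ = weight n ^ 2 * weight n ^ a := by
            rw [Real.rpow_add hw0, Real.rpow_two, mul_comm]
        _ ≤ (2 * normSq n) ^ 2 * weight n ^ a := by gcongr
        _ = _ := by ring

/-- The inverse `Δ⁻¹ : H^a → H^b`, `b ≤ a + 2`, of the Laplacian, killing the constants. -/
def invLaplacian (hb : 3 / 2 < b) (hab : b ≤ a + 2) : Sobolev a →L[ℝ] Sobolev b :=
  (exists_invLaplacian hb hab).choose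

theorem hat_invLaplacian (hb : 3 / 2 < b) (hab : b ≤ a + 2) (f : Sobolev a) (n : Fin 3 → ℤ) :
    hat n (invLaplacian hb hab f) = -((normSq n : ℂ))⁻¹ * hat n f :=
  (exists_invLaplacian hb hab).choose_spec f n

theorem exists_subMean (ha : 3 / 2 < a) :
    ∃ T : Sobolev a →L[ℝ] Sobolev a, ∀ f n, hat n (T f) = (if n = 0 then 0 else 1) * hat n f := by
  refine exists_multiplier ha (C := 1) (fun n => ?_) fun n => ?_
  · by_cases hn : n = 0 <;> simp [hn]
  · have hwa : 0 ≤ weight n ^ a := Real.rpow_nonneg (weight_pos n).le _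
    by_cases hn : n = 0
    · simp [hn, weight]
    · simp [hn]

/-- Subtraction of the mean. -/
def subMean (ha : 3 / 2 < a) : Sobolev a →L[ℝ] Sobolev a := (exists_subMean ha).choose

theorem hat_subMean (ha : 3 / 2 < a) (f : Sobolev a) (n : Fin 3 → ℤ) :
    hat n (subMean ha f) = (if n = 0 then 0 else 1) * hat n f :=
  (exists_subMean ha).choose_spec f n

theorem hat_zero_eq_integral (f : Sobolev a) : hat 0 f = (∫ t, f.toC t ∂torusMeasure : ℝ) := by
  rw [hat_apply, fc_eq_integral, neg_zero, mFourier_zero, ← integral_complex_ofReal]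
  simp

/-- Elements of `H^a`, `a > 5/2`, are differentiable, with the expected partial derivatives. -/
theorem hasFDerivAt_lift (hb : 3 / 2 < b) (hab : b + 1 ≤ a) (f : Sobolev a) (x : E3) :
    HasFDerivAt f.lift
      (∑ j, (partialDeriv j hb hab f).lift x • (EuclideanSpace.proj j : E3 →L[ℝ] ℝ)) x := by
  have ha : 3 / 2 < a := by linarith
  let F' : (Fin 3 → ℤ) → E3 → (E3 →L[ℝ] ℂ) := fun n x =>
    hat n f • (Complex.exp (Complex.I * phase n x) •
      (Complex.I • (Complex.ofRealCLM.comp (phase n))))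
  have hF : ∀ n x, HasFDerivAt (fun x : E3 => hat n f * Complex.exp (Complex.I * phase n x))
      (F' n x) x := fun n x => by
    have h1 : HasFDerivAt (fun x : E3 => ((phase n x : ℝ) : ℂ))
        (Complex.ofRealCLM.comp (phase n)) x :=
      (Complex.ofRealCLM.comp (phase n)).hasFDerivAt
    exact ((h1.const_mul Complex.I).cexp).const_mul (hat n f)
  -- The derivatives of the terms are dominated by the coefficients of the partial derivatives,
  -- which are summable because `b > 3/2`; so the series may be differentiated termwise.
  have hbound : ∀ n x, ‖F' n x‖ ≤ ∑ j, ‖hat n (partialDeriv j hb hab f)‖ := fun n x => by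
    have h0 : ‖Complex.ofRealCLM.comp (phase n)‖ ≤ ∑ i, |(n i : ℝ)| := by
      refine (ContinuousLinearMap.opNorm_comp_le _ _).trans ?_
      rw [Complex.ofRealCLM_norm, one_mul]
      exact norm_phase_le n
    simp only [F', norm_smul, norm_exp_phase, Complex.norm_I, one_mul, hat_partialDeriv, norm_mul,
      Complex.norm_intCast]
    rw [← Finset.sum_mul, mul_comm]
    gcongr
  have hsum : Summable fun n => ∑ j, ‖hat n (partialDeriv j hb hab f)‖ :=
    summable_sum fun j _ => summable_fc hb _
  have h := hasFDerivAt_tsum hsum hF hbound (hasSum_lift ha f 0).summable x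
  have hre := Complex.reCLM.hasFDerivAt.comp x h
  have e1 : (Complex.reCLM ∘ fun y => ∑' n, hat n f * Complex.exp (Complex.I * phase n y)) =
      f.lift := by
    funext y
    simp [(hasSum_lift ha f y).tsum_eq]
  have e2 : HasSum (fun n => F' n x) (∑ j, ((partialDeriv j hb hab f).lift x : ℂ) •
      Complex.ofRealCLM.comp (EuclideanSpace.proj j : E3 →L[ℝ] ℝ)) := by
    have h3 := hasSum_sum (s := Finset.univ) fun (j : Fin 3) _ =>
      (hasSum_lift hb (partialDeriv j hb hab f) x).smul_const
        (Complex.ofRealCLM.comp (EuclideanSpace.proj j : E3 →L[ℝ] ℝ))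
    refine h3.congr_fun fun n => ?_
    ext v
    simp only [F', hat_partialDeriv, Fin.sum_univ_three, add_apply, smul_apply,
      ContinuousLinearMap.comp_apply, phase_apply, smul_eq_mul, Complex.ofRealCLM_apply,
      PiLp.proj_apply]
    push_cast
    ring
  rw [e1, e2.tsum_eq] at hre
  refine hre.congr_fderiv ?_
  ext v
  simp

theorem fderiv_lift_single (hb : 3 / 2 < b) (hab : b + 1 ≤ a) (f : Sobolev a) (x : E3)
    (j : Fin 3) : fderiv ℝ f.lift x (EuclideanSpace.single j 1) =
      (partialDeriv j hb hab f).lift x := by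
  rw [(hasFDerivAt_lift hb hab f x).fderiv]
  simp

theorem gradient_lift (hb : 3 / 2 < b) (hab : b + 1 ≤ a) (f : Sobolev a) (x : E3) :
    ∇ f.lift x = WithLp.toLp 2 fun j => (partialDeriv j hb hab f).lift x := by
  refine HasGradientAt.gradient ?_
  rw [hasGradientAt_iff_hasFDerivAt]
  refine (hasFDerivAt_lift hb hab f x).congr_fderiv ?_
  ext v
  simp [PiLp.inner_apply, mul_comm]

end Sobolev

/-! ### The Jacobian determinant as a polynomial map. -/

open Sobolev

variable {s : ℝ}

theorem meanZero_iff (w : VSobolev s) : MeanZero w ↔ ∀ i, hat 0 (w i) = 0 := by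
  simp only [MeanZero, hat_zero_eq_integral, Complex.ofReal_eq_zero]

/-- The entry `∂_j w_i` of the Jacobian matrix. -/
def jacobianEntry (hs : 5 / 2 < s) (i j : Fin 3) : VSobolev s →L[ℝ] Sobolev (s - 1) :=
  (partialDeriv j (by linarith) (by linarith)).comp (PiLp.proj 2 (fun _ : Fin 3 => Sobolev s) i)

theorem jacobianEntry_apply (hs : 5 / 2 < s) (i j : Fin 3) (w : VSobolev s) :
    jacobianEntry hs i j w = partialDeriv j (by linarith) (by linarith) (w i) := rfl

theorem hat_jacobianEntry (hs : 5 / 2 < s) (i j : Fin 3) (w : VSobolev s) (n : Fin 3 → ℤ) :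
    hat n (jacobianEntry hs i j w) = Complex.I * n j * hat n (w i) :=
  hat_partialDeriv _ _ _ _ _

/-- The divergence as a bounded operator. -/
def divOp (hs : 5 / 2 < s) : VSobolev s →L[ℝ] Sobolev (s - 1) := ∑ i, jacobianEntry hs i i

theorem divOp_apply (hs : 5 / 2 < s) (w : VSobolev s) :
    divOp hs w = ∑ i, jacobianEntry hs i i w := by simp [divOp]

theorem hat_divOp (hs : 5 / 2 < s) (w : VSobolev s) (n : Fin 3 → ℤ) :
    hat n (divOp hs w) = ∑ i, Complex.I * n i * hat n (w i) := by
  rw [divOp_apply, map_sum]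
  exact Finset.sum_congr rfl fun i _ => hat_jacobianEntry hs i i w n

theorem lift_divOp (hs : 5 / 2 < s) (w : VSobolev s) (x : E3) :
    (divOp hs w).lift x = ∑ i, (jacobianEntry hs i i w).lift x := by
  rw [divOp_apply, Fin.sum_univ_three, Fin.sum_univ_three]; rfl

theorem differentiable_lift (hs : 5 / 2 < s) (f : Sobolev s) : Differentiable ℝ f.lift :=
  fun x => (hasFDerivAt_lift (b := s - 1) (by linarith) (by linarith) f x).differentiableAt

theorem divergence_eq (hs : 5 / 2 < s) (w : VSobolev s) (x : E3) :
    divergence w x = (divOp hs w).lift x := by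
  rw [lift_divOp]
  exact Finset.sum_congr rfl fun i _ => fderiv_lift_single _ _ _ x i

theorem eq_zero_of_lift {a : ℝ} {f : Sobolev a} (h : ∀ x, f.lift x = 0) : f = 0 :=
  Subtype.ext (lift_ext (g := (0 : Sobolev a)) h)

theorem mem_H0_iff (hs : 5 / 2 < s) (w : VSobolev s) :
    w ∈ H0 s ↔ divOp hs w = 0 ∧ MeanZero w := by
  constructor
  · intro h
    exact ⟨eq_zero_of_lift fun x => (divergence_eq hs w x).symm.trans (h.2.1 x), h.2.2⟩
  · intro h
    refine ⟨fun i => differentiable_lift hs _, fun x => ?_, h.2⟩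
    rw [divergence_eq hs, h.1]; rfl

/-- The minor of the Jacobian matrix with rows `i, i'` and columns `j, j'`. -/
def minor (hs : 5 / 2 < s) (i i' j j' : Fin 3) (w : VSobolev s) : Sobolev (s - 1) :=
  mul (by linarith) (jacobianEntry hs i j w) (jacobianEntry hs i' j' w) -
    mul (by linarith) (jacobianEntry hs i j' w) (jacobianEntry hs i' j w)

/-- The determinant of the Jacobian matrix. -/
def cubicPart (hs : 5 / 2 < s) (w : VSobolev s) : Sobolev (s - 1) :=
  mul (by linarith) (minor hs 0 1 0 1 w) (jacobianEntry hs 2 2 w) -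
    mul (by linarith) (minor hs 0 1 0 2 w) (jacobianEntry hs 2 1 w) +
    mul (by linarith) (minor hs 0 1 1 2 w) (jacobianEntry hs 2 0 w)

/-- The nonlinear part `det (1 + w') - 1 - div w` of the Jacobian determinant of `x + w(x)`. -/
def detRem (hs : 5 / 2 < s) (w : VSobolev s) : Sobolev (s - 1) :=
  minor hs 0 1 0 1 w + minor hs 0 2 0 2 w + minor hs 1 2 1 2 w + cubicPart hs w

theorem contDiff_minor (hs : 5 / 2 < s) (i i' j j' : Fin 3) {n : WithTop ℕ∞} :
    ContDiff ℝ n (minor hs i i' j j') := by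
  unfold minor
  fun_prop

/-- A polynomial in bounded linear and bilinear maps; `n` may be the analytic class. -/
theorem contDiff_detRem (hs : 5 / 2 < s) {n : WithTop ℕ∞} : ContDiff ℝ n (detRem hs) := by
  have h := fun i i' j j' => contDiff_minor hs i i' j j' (n := n)
  unfold detRem cubicPart
  fun_prop

/-- By the Leibniz rule, each term of the derivative keeps a factor that vanishes at `0`. -/
theorem hasFDerivAt_mul_zero {E F : Type*} [NormedAddCommGroup E] [NormedSpace ℝ E]
    [NormedAddCommGroup F] [NormedSpace ℝ F] (B : F →L[ℝ] F →L[ℝ] F) {f g : E → F}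
    (hf : DifferentiableAt ℝ f 0) (hg : DifferentiableAt ℝ g 0) (hf0 : f 0 = 0) (hg0 : g 0 = 0) :
    HasFDerivAt (fun x => B (f x) (g x)) (0 : E →L[ℝ] F) 0 := by
  have h := ((B.hasFDerivAt (x := f 0)).comp 0 hf.hasFDerivAt).clm_apply hg.hasFDerivAt
  refine h.congr_fderiv ?_
  ext v
  simp [hf0, hg0]

theorem minor_zero (hs : 5 / 2 < s) (i i' j j' : Fin 3) : minor hs i i' j j' 0 = 0 := by
  simp [minor]

theorem hasFDerivAt_detRem_zero (hs : 5 / 2 < s) :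
    HasFDerivAt (detRem hs) (0 : VSobolev s →L[ℝ] Sobolev (s - 1)) 0 := by
  have hr : 3 / 2 < s - 1 := by linarith
  have hj : ∀ i j, DifferentiableAt ℝ (jacobianEntry hs i j) 0 :=
    fun i j => (jacobianEntry hs i j).differentiableAt
  have hj0 : ∀ i j, jacobianEntry hs i j 0 = 0 := fun i j => map_zero _
  have hm : ∀ i i' j j', HasFDerivAt (minor hs i i' j j')
      (0 : VSobolev s →L[ℝ] Sobolev (s - 1)) 0 := fun i i' j j' => by
    exact ((hasFDerivAt_mul_zero (mul hr) (hj i j) (hj i' j') (hj0 _ _) (hj0 _ _)).sub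
      (hasFDerivAt_mul_zero (mul hr) (hj i j') (hj i' j) (hj0 _ _) (hj0 _ _))).congr_fderiv
      (sub_zero _)
  have hc : ∀ i i' j j' k l, HasFDerivAt
      (fun w => mul hr (minor hs i i' j j' w) (jacobianEntry hs k l w))
      (0 : VSobolev s →L[ℝ] Sobolev (s - 1)) 0 := fun i i' j j' k l =>
    hasFDerivAt_mul_zero (mul hr) (hm i i' j j').differentiableAt (hj k l) (minor_zero _ _ _ _ _)
      (hj0 _ _)
  have hcub := ((hc 0 1 0 1 2 2).sub (hc 0 1 0 2 2 1)).add (hc 0 1 1 2 2 0)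
  exact ((((hm 0 1 0 1).add (hm 0 2 0 2)).add (hm 1 2 1 2)).add hcub).congr_fderiv (by simp)

/-- The Jacobian determinant of a periodic perturbation of the identity has mean one. -/
theorem hat_zero_detRem (hs : 5 / 2 < s) (w : VSobolev s) : hat 0 (detRem hs w) = 0 := by
  have hr : 3 / 2 < s - 1 := by linarith
  -- At total frequency zero the factors have frequencies `m` and `-m`, and the two products of the
  -- minor agree term by term.
  have hquad : ∀ i j, hat 0 (minor hs i j i j w) = 0 := fun i j => by
    rw [minor, map_sub, sub_eq_zero]
    refine (hasSum_hat_mul hr _ _ 0).unique ((hasSum_hat_mul hr _ _ 0).congr_fun fun m => ?_)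
    simp only [hat_jacobianEntry, zero_sub, Pi.neg_apply]
    push_cast
    ring
  have hminor : ∀ (j j' : Fin 3) (k : Fin 3 → ℤ), HasSum
      (fun m : Fin 3 → ℤ => -((m j : ℂ) * (k j' - m j') - m j' * (k j - m j)) *
        (hat m (w 0) * hat (k - m) (w 1))) (hat k (minor hs 0 1 j j' w)) := fun j j' k => by
    rw [minor, map_sub]
    refine ((hasSum_hat_mul hr _ _ k).sub (hasSum_hat_mul hr _ _ k)).congr_fun fun m => ?_
    simp only [hat_jacobianEntry, Pi.sub_apply]
    push_cast
    linear_combination (-((m j : ℂ) * (k j' - m j') - m j' * (k j - m j)) *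
        (hat m (w 0) * hat (k - m) (w 1))) * Complex.I_sq
  have hcub : hat 0 (cubicPart hs w) = 0 := by
    rw [cubicPart, map_add, map_sub]
    refine (((hasSum_hat_mul hr _ _ 0).sub (hasSum_hat_mul hr _ _ 0)).add
      (hasSum_hat_mul hr _ _ 0)).unique (hasSum_zero.congr_fun fun k => ?_)
    -- The three factors have frequencies `m`, `k - m` and `-k`, whose sum is zero. The expansion
    -- produces the determinant of these dependent vectors, so every term vanishes.
    have h := (((hminor 0 1 k).mul_right ((k 2 : ℂ))).sub ((hminor 0 2 k).mul_right (k 1 : ℂ))).add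
      ((hminor 1 2 k).mul_right (k 0 : ℂ))
    have h0 := h.unique (hasSum_zero.congr_fun fun m => by ring)
    simp only [hat_jacobianEntry, zero_sub, Pi.neg_apply]
    push_cast
    linear_combination (-Complex.I * hat (-k) (w 2)) * h0
  rw [detRem, map_add, map_add, map_add, hquad, hquad, hquad, hcub]
  simp

/-- The Jacobian matrix of `w` at `x`. -/
def jacobian (hs : 5 / 2 < s) (w : VSobolev s) (x : E3) : Matrix (Fin 3) (Fin 3) ℝ :=
  Matrix.of fun i j => (jacobianEntry hs i j w).lift x

theorem hasFDerivAt_displace (hs : 5 / 2 < s) (w : VSobolev s) (x : E3) :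
    HasFDerivAt (displace w)
      (Matrix.toEuclideanCLM (n := Fin 3) (𝕜 := ℝ) (1 + jacobian hs w x)) x := by
  rw [← hasFDerivWithinAt_univ, hasFDerivWithinAt_euclidean]
  intro i
  rw [hasFDerivWithinAt_univ]
  have h1 := (EuclideanSpace.proj i : E3 →L[ℝ] ℝ).hasFDerivAt (x := x)
  have h2 := hasFDerivAt_lift (b := s - 1) (by linarith) (by linarith) (w i) x
  refine (h1.add h2).congr_fderiv ?_
  ext v
  have hv : v = WithLp.toLp 2 v.ofLp := rfl
  simp only [ContinuousLinearMap.comp_apply, add_apply, sum_apply, smul_apply, PiLp.proj_apply]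
  rw [hv, Matrix.toEuclideanCLM_toLp, Matrix.add_mulVec, Matrix.one_mulVec]
  simp [jacobian, Matrix.mulVec, dotProduct, jacobianEntry_apply]

theorem det_toEuclideanCLM (M : Matrix (Fin 3) (Fin 3) ℝ) :
    (Matrix.toEuclideanCLM (n := Fin 3) (𝕜 := ℝ) M).det = M.det := by
  rw [ContinuousLinearMap.det, Matrix.coe_toEuclideanCLM_eq_toEuclideanLin]
  exact LinearMap.det_toLin (PiLp.basisFun 2 ℝ (Fin 3)) M

/-- Expansion of `det (1 + A)` into `1`, the trace, the principal 2×2 minors and `det A`. -/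
theorem det_one_add_jacobian (hs : 5 / 2 < s) (w : VSobolev s) (x : E3) :
    (1 + jacobian hs w x).det = 1 + (divOp hs w + detRem hs w).lift x := by
  have hm : ∀ i i' j j', (minor hs i i' j j' w).lift x =
      jacobian hs w x i j * jacobian hs w x i' j' - jacobian hs w x i j' * jacobian hs w x i' j :=
    fun _ _ _ _ => rfl
  have hc : (cubicPart hs w).lift x = (minor hs 0 1 0 1 w).lift x * jacobian hs w x 2 2 -
    (minor hs 0 1 0 2 w).lift x * jacobian hs w x 2 1 +
    (minor hs 0 1 1 2 w).lift x * jacobian hs w x 2 0 := rfl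
  have hd : (divOp hs w).lift x = ∑ i, jacobian hs w x i i := lift_divOp hs w x
  rw [detRem, lift_add, lift_add, lift_add, lift_add, hc, hm, hm, hm, hm, hm, hd,
    Matrix.det_fin_three, Fin.sum_univ_three]
  simp
  ring

theorem unimodular_displace_iff (hs : 5 / 2 < s) (w : VSobolev s) :
    Unimodular (displace w) ↔ divOp hs w + detRem hs w = 0 := by
  have h : ∀ x, (fderiv ℝ (displace w) x).det = 1 + (divOp hs w + detRem hs w).lift x := fun x => by
    rw [(hasFDerivAt_displace hs w x).fderiv, det_toEuclideanCLM, det_one_add_jacobian]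
  simp only [Unimodular, h, add_eq_left]
  refine ⟨eq_zero_of_lift, fun h x => ?_⟩
  rw [h]; rfl

/-! ### Bijectivity near the identity. -/

/-- Small displacements give bijections. -/
theorem exists_bijective_displace (hs : 5 / 2 < s) :
    ∃ δ > 0, ∀ w : VSobolev s, ‖w‖ < δ → Function.Bijective (displace w) := by
  have hr : 3 / 2 < s - 1 := by linarith
  let K : ℝ := ∑ i, ∑ j, embConst (s - 1) * ‖jacobianEntry hs i j‖
  have hK : 0 ≤ K := Finset.sum_nonneg fun i _ => Finset.sum_nonneg fun j _ =>
    mul_nonneg (embConst_nonneg _) (norm_nonneg _)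
  have hlip : ∀ (w : VSobolev s) (x y : E3),
      ‖vlift w x - vlift w y‖ ≤ 2 * (K * ‖w‖) * ‖x - y‖ := fun w x y => by
    have hi : ∀ i, ‖(w i).lift x - (w i).lift y‖ ≤ K * ‖w‖ * ‖x - y‖ := fun i => by
      refine Convex.norm_image_sub_le_of_norm_hasFDerivWithin_le (s := Set.univ)
        (fun z _ => (hasFDerivAt_lift hr (by linarith) (w i) z).hasFDerivWithinAt)
        (fun z _ => ?_) convex_univ (Set.mem_univ y) (Set.mem_univ x)
      refine (norm_sum_le _ _).trans ?_
      calc _ ≤ ∑ j, embConst (s - 1) * ‖jacobianEntry hs i j‖ * ‖w‖ := by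
            refine Finset.sum_le_sum fun j _ => ?_
            rw [norm_smul, Real.norm_eq_abs]
            refine (mul_le_of_le_one_right (abs_nonneg _) (norm_proj_le j)).trans ?_
            refine (abs_lift_le hr _ z).trans ?_
            rw [mul_assoc]
            exact mul_le_mul_of_nonneg_left ((jacobianEntry hs i j).le_opNorm w)
              (embConst_nonneg _)
        _ ≤ _ := by
            rw [← Finset.sum_mul]
            refine mul_le_mul_of_nonneg_right ?_ (norm_nonneg _)
            exact Finset.single_le_sum
              (f := fun i => ∑ j, embConst (s - 1) * ‖jacobianEntry hs i j‖)
              (fun i _ => Finset.sum_nonneg fun j _ =>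
                mul_nonneg (embConst_nonneg _) (norm_nonneg _)) (Finset.mem_univ i)
    have hB : 0 ≤ K * ‖w‖ * ‖x - y‖ := by positivity
    -- Three components bounded by `B` give a squared norm of at most `3B² ≤ (2B)²`.
    refine abs_le_of_sq_le_sq' ?_ (by positivity) |>.2
    rw [EuclideanSpace.norm_sq_eq, Fin.sum_univ_three]
    have hsq : ∀ i, ‖(vlift w x - vlift w y) i‖ ^ 2 ≤ (K * ‖w‖ * ‖x - y‖) ^ 2 :=
      fun i => pow_le_pow_left₀ (norm_nonneg _) (hi i) 2
    nlinarith [hsq 0, hsq 1, hsq 2]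
  -- This radius makes the Lipschitz constant `2K‖w‖` of the displacement at most `1/2`, so the map
  -- is a contractive perturbation of the identity.
  refine ⟨1 / (4 * (K + 1)), by positivity, fun w hw => ?_⟩
  have hsmall : 2 * (K * ‖w‖) ≤ 1 / 2 := by
    have h1 : ‖w‖ * (4 * (K + 1)) < 1 := by rwa [lt_div_iff₀ (by positivity)] at hw
    nlinarith [norm_nonneg w]
  have happ : ApproximatesLinearOn (displace w)
      ((ContinuousLinearEquiv.refl ℝ E3 : E3 ≃L[ℝ] E3) : E3 →L[ℝ] E3) Set.univ
      (1 / 2 : NNReal) := by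
    intro x _ y _
    have e : displace w x - displace w y -
        ((ContinuousLinearEquiv.refl ℝ E3 : E3 ≃L[ℝ] E3) : E3 →L[ℝ] E3) (x - y) =
        vlift w x - vlift w y := by
      simp only [displace, ContinuousLinearEquiv.coe_refl, ContinuousLinearMap.id_apply]
      abel
    rw [e]
    refine (hlip w x y).trans ?_
    push_cast
    gcongr
  have hc : Subsingleton E3 ∨ (1 / 2 : NNReal) <
      ‖((ContinuousLinearEquiv.refl ℝ E3).symm : E3 →L[ℝ] E3)‖₊⁻¹ := by
    right
    rw [ContinuousLinearEquiv.refl_symm, ContinuousLinearEquiv.coe_refl,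
      ContinuousLinearMap.nnnorm_id, inv_one]
    exact NNReal.half_lt_self one_ne_zero
  exact ⟨Set.injOn_univ.1 (happ.injOn hc), happ.surjective hc⟩

/-! ### Gradient, Poisson equation and Helmholtz projection. -/

theorem ext_vhat {v w : VSobolev s} (h : ∀ i n, hat n (v i) = hat n (w i)) : v = w := by
  ext i
  exact ext_hat (h i)

/-- A bounded operator to vector fields from its components. -/
def ofComponents {E : Type*} [NormedAddCommGroup E] [NormedSpace ℝ E]
    (T : Fin 3 → E →L[ℝ] Sobolev s) : E →L[ℝ] VSobolev s :=
  ((PiLp.continuousLinearEquiv 2 ℝ fun _ : Fin 3 => Sobolev s).symm :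
    (Fin 3 → Sobolev s) →L[ℝ] VSobolev s).comp (ContinuousLinearMap.pi T)

/-- The gradient `H^{s+1}(T³) → H^s(T³, ℝ³)`. -/
def gradOp (hs : 5 / 2 < s) : Sobolev (s + 1) →L[ℝ] VSobolev s :=
  ofComponents fun i => partialDeriv i (by linarith) le_rfl

theorem hat_gradOp (hs : 5 / 2 < s) (φ : Sobolev (s + 1)) (i : Fin 3) (n : Fin 3 → ℤ) :
    hat n (gradOp hs φ i) = Complex.I * n i * hat n φ := hat_partialDeriv _ _ _ _ _

theorem gradient_lift_eq (hs : 5 / 2 < s) (φ : Sobolev (s + 1)) (x : E3) :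
    ∇ φ.lift x = vlift (gradOp hs φ) x := gradient_lift _ _ _ _

theorem gMap_eq (hs : 5 / 2 < s) (v : VSobolev s) (φ : Sobolev (s + 1)) :
    gMap v φ = displace (v + gradOp hs φ) := by
  funext x
  rw [gMap, gradient_lift_eq hs, add_assoc]
  rfl

theorem displace_injective {v w : VSobolev s} (h : displace v = displace w) : v = w := by
  ext i
  refine Subtype.ext (lift_ext fun x => ?_)
  exact congrArg (fun y : E3 => y i) (add_left_cancel (congrFun h x))

/-- The Poisson equation `Δφ = h` is solved up to the mean of `h`. -/
def poisson (hs : 5 / 2 < s) : Sobolev (s - 1) →L[ℝ] Sobolev (s + 1) :=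
  invLaplacian (by linarith) (by linarith)

theorem hat_poisson (hs : 5 / 2 < s) (h : Sobolev (s - 1)) (n : Fin 3 → ℤ) :
    hat n (poisson hs h) = -((normSq n : ℂ))⁻¹ * hat n h := hat_invLaplacian _ _ _ _

theorem meanZero_gradOp (hs : 5 / 2 < s) (φ : Sobolev (s + 1)) : MeanZero (gradOp hs φ) := by
  rw [meanZero_iff]
  intro i
  simp [hat_gradOp]

theorem hat_divOp_gradOp (hs : 5 / 2 < s) (φ : Sobolev (s + 1)) (n : Fin 3 → ℤ) :
    hat n (divOp hs (gradOp hs φ)) = -(normSq n) * hat n φ := by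
  simp only [hat_divOp, hat_gradOp, normSq, Fin.sum_univ_three]
  push_cast
  linear_combination ((n 0 : ℂ) ^ 2 + n 1 ^ 2 + n 2 ^ 2) * hat n φ * Complex.I_sq

theorem divOp_gradOp_poisson (hs : 5 / 2 < s) {h : Sobolev (s - 1)} (h0 : hat 0 h = 0) :
    divOp hs (gradOp hs (poisson hs h)) = h := by
  refine ext_hat fun n => ?_
  rw [hat_divOp_gradOp, hat_poisson]
  by_cases hn : n = 0
  · simp [hn, h0]
  · have : (normSq n : ℂ) ≠ 0 := by
      have := one_le_normSq hn
      exact_mod_cast (by linarith : (0 : ℝ) < normSq n).ne'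
    field_simp

/-- `Δ⁻¹Δφ` differs from `φ` only in the mean, which the gradient does not see. -/
theorem gradOp_poisson_divOp (hs : 5 / 2 < s) (φ : Sobolev (s + 1)) :
    gradOp hs (poisson hs (divOp hs (gradOp hs φ))) = gradOp hs φ := by
  refine ext_vhat fun i n => ?_
  rw [hat_gradOp, hat_gradOp, hat_poisson, hat_divOp_gradOp]
  by_cases hn : n = 0
  · simp [hn]
  · have : (normSq n : ℂ) ≠ 0 := by
      have := one_le_normSq hn
      exact_mod_cast (by linarith : (0 : ℝ) < normSq n).ne'
    field_simp

/-- The Helmholtz projection to the divergence free fields of mean zero. -/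
def helmholtz (hs : 5 / 2 < s) : VSobolev s →L[ℝ] VSobolev s :=
  ofComponents (fun i => (subMean (by linarith)).comp
    (PiLp.proj 2 (fun _ : Fin 3 => Sobolev s) i)) - (gradOp hs).comp ((poisson hs).comp (divOp hs))

theorem helmholtz_of_meanZero (hs : 5 / 2 < s) {w : VSobolev s} (hw : MeanZero w) :
    helmholtz hs w = w - gradOp hs (poisson hs (divOp hs w)) := by
  rw [meanZero_iff] at hw
  rw [helmholtz, sub_apply]
  congr 1
  refine ext_vhat fun i n => ?_
  refine (hat_subMean _ _ n).trans ?_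
  by_cases hn : n = 0
  · simp [hn, hw]
  · simp [hn]

theorem hat_helmholtz (hs : 5 / 2 < s) (w : VSobolev s) (i : Fin 3) (n : Fin 3 → ℤ) :
    hat n (helmholtz hs w i) = (if n = 0 then 0 else 1) * hat n (w i) -
      Complex.I * n i * (-((normSq n : ℂ))⁻¹ * hat n (divOp hs w)) := by
  rw [← hat_poisson hs, ← hat_gradOp hs, ← hat_subMean (by linarith)]
  exact map_sub _ _ _

theorem helmholtz_mem (hs : 5 / 2 < s) (w : VSobolev s) : helmholtz hs w ∈ H0 s := by
  rw [mem_H0_iff hs, meanZero_iff]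
  refine ⟨ext_hat fun n => ?_, fun i => by simp [hat_helmholtz]⟩
  rw [map_zero, hat_divOp]
  simp only [hat_helmholtz]
  by_cases hn : n = 0
  · simp [hn]
  · have hN : (normSq n : ℂ) ≠ 0 := by
      have := one_le_normSq hn
      exact_mod_cast (by linarith : (0 : ℝ) < normSq n).ne'
    have hd := hat_divOp hs w n
    have hS : (normSq n : ℂ) = (n 0 : ℂ) ^ 2 + n 1 ^ 2 + n 2 ^ 2 := by
      simp [normSq, Fin.sum_univ_three]
    rw [Fin.sum_univ_three] at hd ⊢
    simp only [hn, if_false, one_mul]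
    linear_combination -hd + (normSq n : ℂ)⁻¹ * hat n (divOp hs w) *
      ((n 0 : ℂ) ^ 2 + n 1 ^ 2 + n 2 ^ 2) * Complex.I_sq +
      (normSq n : ℂ)⁻¹ * hat n (divOp hs w) * hS - hat n (divOp hs w) * inv_mul_cancel₀ hN

/-! ### The straightening map and its local inverse. -/

/-- The nonlinear change of variables that turns unimodular displacements into divergence free
fields. -/
def straighten (hs : 5 / 2 < s) (w : VSobolev s) : VSobolev s :=
  w + gradOp hs (poisson hs (detRem hs w))

theorem contDiff_straighten (hs : 5 / 2 < s) {n : WithTop ℕ∞} :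
    ContDiff ℝ n (straighten hs) := by
  have := contDiff_detRem hs (n := n)
  unfold straighten
  fun_prop

theorem detRem_zero (hs : 5 / 2 < s) : detRem hs 0 = 0 := by
  simp [detRem, cubicPart, minor_zero]

theorem straighten_zero (hs : 5 / 2 < s) : straighten hs 0 = 0 := by
  simp [straighten, detRem_zero]

theorem hasFDerivAt_straighten_zero (hs : 5 / 2 < s) :
    HasFDerivAt (straighten hs) (ContinuousLinearMap.id ℝ (VSobolev s)) 0 := by
  have h := (hasFDerivAt_id (𝕜 := ℝ) (0 : VSobolev s)).add
    (((gradOp hs).comp (poisson hs)).hasFDerivAt.comp 0 (hasFDerivAt_detRem_zero hs))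
  exact h.congr_fderiv (by simp)

/-- Unimodularity says `detRem w = -div w`, and with this the two formulas coincide. So the inverse
of the chart is linear. -/
theorem straighten_eq_helmholtz (hs : 5 / 2 < s) {w : VSobolev s}
    (hu : Unimodular (displace w)) (hw : MeanZero w) : straighten hs w = helmholtz hs w := by
  rw [unimodular_displace_iff hs, add_comm, add_eq_zero_iff_eq_neg] at hu
  rw [straighten, hu, helmholtz_of_meanZero hs hw, map_neg, map_neg]
  exact (sub_eq_add_neg _ _).symm

/-- As `detRem w` has mean zero, the divergence of `straighten hs w` is `div w + detRem w`; the
added gradient does not change the mean. -/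
theorem unimodular_of_straighten_mem (hs : 5 / 2 < s) {w : VSobolev s}
    (h : straighten hs w ∈ H0 s) : Unimodular (displace w) ∧ MeanZero w := by
  rw [mem_H0_iff hs, straighten, map_add, divOp_gradOp_poisson hs (hat_zero_detRem hs w)] at h
  refine ⟨(unimodular_displace_iff hs w).2 h.1, ?_⟩
  have h1 := (meanZero_iff _).1 (meanZero_gradOp hs (poisson hs (detRem hs w)))
  rw [meanZero_iff] at h ⊢
  intro i
  have h2 := h.2 i
  rw [PiLp.add_apply, map_add, h1, add_zero] at h2
  exact h2

theorem helmholtz_add_gradOp (hs : 5 / 2 < s) {v : VSobolev s} (hv : v ∈ H0 s)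
    (ψ : Sobolev (s + 1)) : MeanZero (v + gradOp hs ψ) ∧ helmholtz hs (v + gradOp hs ψ) = v := by
  rw [mem_H0_iff hs] at hv
  have hm : MeanZero (v + gradOp hs ψ) := by
    have h1 := (meanZero_iff _).1 (meanZero_gradOp hs ψ)
    have h2 := (meanZero_iff _).1 hv.2
    rw [meanZero_iff]
    intro i
    rw [PiLp.add_apply, map_add, h1, h2, add_zero]
  refine ⟨hm, ?_⟩
  rw [helmholtz_of_meanZero hs hm, map_add, hv.1, zero_add, gradOp_poisson_divOp,
    add_sub_cancel_right]

theorem exists_const_of_gradOp_eq (hs : 5 / 2 < s) {φ ψ : Sobolev (s + 1)}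
    (h : gradOp hs ψ = gradOp hs φ) : ∃ c : ℝ, ∀ x, ψ.lift x = φ.lift x + c := by
  have hs' : 5 / 2 < s + 1 := by linarith
  have hd : Differentiable ℝ fun x => ψ.lift x - φ.lift x :=
    (differentiable_lift hs' ψ).sub (differentiable_lift hs' φ)
  refine ⟨ψ.lift 0 - φ.lift 0, fun x => ?_⟩
  have hc := is_const_of_fderiv_eq_zero (𝕜 := ℝ) hd (fun y => ?_) x 0
  · linarith
  have e : ∀ j, partialDeriv j (by linarith) le_rfl ψ =
      (partialDeriv j (by linarith) le_rfl φ : Sobolev s) := fun j =>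
    congrArg (fun v : VSobolev s => v j) h
  have hψ := hasFDerivAt_lift (b := s) (by linarith) le_rfl ψ y
  have hφ := hasFDerivAt_lift (b := s) (by linarith) le_rfl φ y
  simp only [e] at hψ
  exact ((hψ.sub hφ).congr_fderiv (sub_self _)).fderiv

theorem exists_analytic_local_inverse_straighten (hs : 5 / 2 < s) :
    ∃ e : OpenPartialHomeomorph (VSobolev s) (VSobolev s),
      ⇑e = straighten hs ∧ (0 : VSobolev s) ∈ e.source ∧ (0 : VSobolev s) ∈ e.target ∧
        AnalyticAt ℝ e.symm 0 ∧ e.symm 0 = 0 := by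
  have hcs : CompleteSpace (Sobolev s) := Sobolev.completeSpace (by linarith)
  -- Here `⊤` is the analytic class, not `C^∞`, so the inverse function theorem returns an analytic
  -- inverse.
  have hc : ContDiffAt ℝ ⊤ (straighten hs) 0 := (contDiff_straighten hs).contDiffAt
  have hd : HasFDerivAt (straighten hs)
      ((ContinuousLinearEquiv.refl ℝ (VSobolev s) : VSobolev s ≃L[ℝ] VSobolev s) :
        VSobolev s →L[ℝ] VSobolev s) 0 := hasFDerivAt_straighten_zero hs
  let e := hc.toOpenPartialHomeomorph (straighten hs) hd (by simp)
  have he : ⇑e = straighten hs := rfl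
  have h0 : (0 : VSobolev s) ∈ e.source := hc.mem_toOpenPartialHomeomorph_source hd _
  have h0t : (0 : VSobolev s) ∈ e.target := by
    have := e.map_source h0
    rwa [he, straighten_zero] at this
  have hsymm : e.symm 0 = 0 := by
    have := e.left_inv h0
    rwa [he, straighten_zero] at this
  refine ⟨e, he, h0, h0t, ?_, hsymm⟩
  exact (e.contDiffAt_symm h0t (by rwa [hsymm]) (by rwa [hsymm])).analyticAt

end TorusChart

end

/-! ### Construction of the chart. -/

open TorusChart in
theorem lemma2p4 (s : ℝ) (hs : 5 / 2 < s) :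
    ∃ ε > (0 : ℝ), ∃ δ > (0 : ℝ), ∃ G : TorusChart.H0 s → TorusChart.VSobolev s,
      -- existence, and uniqueness near the identity
      (∀ v : TorusChart.H0 s, ‖v‖ < ε →
        ∃ φ : TorusChart.Sobolev (s + 1),
          TorusChart.gMap v.1 φ = TorusChart.displace (G v) ∧ ‖G v‖ < δ ∧
          TorusChart.Unimodular (TorusChart.gMap v.1 φ) ∧ G v ∈ TorusChart.D s ∧
          ∀ ψ : TorusChart.Sobolev (s + 1),
            TorusChart.NearId s δ (TorusChart.gMap v.1 ψ) →
            TorusChart.Unimodular (TorusChart.gMap v.1 ψ) →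
            ∃ c : ℝ, ∀ x, ψ.lift x = φ.lift x + c) ∧
      -- analyticity
      AnalyticOnNhd ℝ G (Metric.ball 0 ε) ∧
      -- the map is an analytic chart near the identity
      ∃ U : Set (TorusChart.VSobolev s), IsOpen U ∧ 0 ∈ U ∧
        G '' Metric.ball 0 ε = U ∩ TorusChart.D s ∧
        ∃ R : TorusChart.VSobolev s → TorusChart.H0 s,
          AnalyticOnNhd ℝ R U ∧ ∀ v ∈ Metric.ball 0 ε, R (G v) = v := by
  have hcs : CompleteSpace (Sobolev s) := Sobolev.completeSpace (by linarith)
  obtain ⟨e, he, h0, h0t, han, hsymm⟩ := exists_analytic_local_inverse_straighten hs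
  obtain ⟨δ₁, hδ₁, hbij⟩ := exists_bijective_displace hs
  obtain ⟨δ₂, hδ₂, hball⟩ := Metric.isOpen_iff.1 e.open_source 0 h0
  have hδ : 0 < min δ₁ δ₂ := lt_min hδ₁ hδ₂
  -- Below `δ₁` displacements are bijective; below `δ₂` they lie where `straighten` is injective,
  -- which gives uniqueness.
  set δ := min δ₁ δ₂ with hδdef
  have hsrc : ∀ w : VSobolev s, ‖w‖ < δ → w ∈ e.source := fun w hw =>
    hball (mem_ball_zero_iff.2 (hw.trans_le (min_le_right _ _)))
  have hev : ∀ᶠ v in nhds (0 : VSobolev s), v ∈ e.target ∧ AnalyticAt ℝ e.symm v ∧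
      ‖e.symm v‖ < δ := by
    refine (e.open_target.eventually_mem h0t).and (han.eventually_analyticAt.and ?_)
    have hc : ContinuousAt (fun v => ‖e.symm v‖) 0 := han.continuousAt.norm
    refine hc.eventually_lt continuousAt_const ?_
    rwa [hsymm, norm_zero]
  -- On the `ε`-ball the local inverse is defined, analytic and of norm less than `δ`.
  obtain ⟨ε, hε, hεball⟩ := Metric.eventually_nhds_iff.1 hev
  simp only [dist_zero_right] at hεball
  let G : H0 s → VSobolev s := fun v => e.symm v.1
  have hG : ∀ v : H0 s, ‖v‖ < ε → ‖G v‖ < δ := fun v hv => (hεball hv).2.2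
  have hstr : ∀ v : H0 s, ‖v‖ < ε → straighten hs (G v) = v.1 := fun v hv => by
    rw [← he]; exact e.right_inv (hεball hv).1
  have huniq : ∀ (v : H0 s) (w : VSobolev s), ‖v‖ < ε → ‖w‖ < δ → straighten hs w = v.1 →
      w = G v := fun v w hv hw h => by
    rw [← he] at h
    change w = e.symm v.1
    rw [← h, e.left_inv (hsrc w hw)]
  have hGu : ∀ v : H0 s, ‖v‖ < ε → Unimodular (displace (G v)) ∧ MeanZero (G v) := fun v hv =>
    unimodular_of_straighten_mem hs (by rw [hstr v hv]; exact v.2)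
  have hanG : AnalyticOnNhd ℝ G (Metric.ball 0 ε) := fun v hv =>
    AnalyticAt.comp (g := e.symm) (hεball (mem_ball_zero_iff.1 hv)).2.1
      ((H0 s).subtypeL.analyticAt v)
  have hSD : ∀ v : H0 s, ‖v‖ < ε → G v ∈ SDiff s := fun v hv =>
    ⟨hbij _ ((hG v hv).trans_le (min_le_left _ _)), hGu v hv⟩
  have hG0 : G 0 = 0 := hsymm
  have hD : ∀ v : H0 s, ‖v‖ < ε → G v ∈ D s := by
    have hpre : IsPreconnected (G '' Metric.ball 0 ε) :=
      (convex_ball (0 : H0 s) ε).isPreconnected.image G hanG.continuousOn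
    have hsub := hpre.subset_connectedComponentIn (F := SDiff s) (x := 0)
      ⟨0, Metric.mem_ball_self hε, hG0⟩
      (by rintro _ ⟨v, hv, rfl⟩; exact hSD v (mem_ball_zero_iff.1 hv))
    exact fun v hv => hsub ⟨v, mem_ball_zero_iff.2 hv, rfl⟩
  have hDS : D s ⊆ SDiff s := connectedComponentIn_subset _ _
  let R : VSobolev s →L[ℝ] H0 s := (helmholtz hs).codRestrict (H0 s) (helmholtz_mem hs)
  have hRG : ∀ v : H0 s, ‖v‖ < ε → R (G v) = v := fun v hv => Subtype.ext <| by
    change helmholtz hs (G v) = v.1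
    rw [← straighten_eq_helmholtz hs (hGu v hv).1 (hGu v hv).2, hstr v hv]
  have hcont : Continuous (straighten hs) := (contDiff_straighten (n := 0) hs).continuous
  refine ⟨ε, hε, δ, hδ, G, fun v hv => ?_, hanG,
    -- On `D` the second condition says `‖R w‖ < ε`, so that `R w` lies in the domain of the chart.
    {w | ‖w‖ < δ ∧ ‖straighten hs w‖ < ε}, ?_, ?_, ?_, R, R.analyticOnNhd _,
    fun v hv => hRG v (mem_ball_zero_iff.1 hv)⟩
  -- Read off from `G v + ∇Δ⁻¹ detRem (G v) = v`.
  · let φ := -poisson hs (detRem hs (G v))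
    have hφ : v.1 + gradOp hs φ = G v := by
      rw [← hstr v hv, straighten, map_neg, add_neg_cancel_right]
    have hg : gMap v.1 φ = displace (G v) := by rw [gMap_eq hs, hφ]
    refine ⟨φ, hg, hG v hv, by rw [hg]; exact (hGu v hv).1, hD v hv, fun ψ hψ hψu => ?_⟩
    obtain ⟨w, hw, hwδ⟩ := hψ
    rw [hw] at hψu
    rw [gMap_eq hs] at hw
    have hw' := displace_injective hw
    obtain ⟨hm, hh⟩ := helmholtz_add_gradOp hs v.2 ψ
    rw [hw'] at hm hh
    have hwG := huniq v w hv hwδ ((straighten_eq_helmholtz hs hψu hm).trans hh)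
    refine exists_const_of_gradOp_eq hs (add_left_cancel (a := v.1) ?_)
    rw [hw', hφ, hwG]
  · exact (isOpen_lt continuous_norm continuous_const).inter
      (isOpen_lt hcont.norm continuous_const)
  · exact ⟨by rwa [norm_zero], by rwa [straighten_zero, norm_zero]⟩
  · ext w
    constructor
    · rintro ⟨v, hv, rfl⟩
      rw [mem_ball_zero_iff] at hv
      exact ⟨⟨hG v hv, by rw [hstr v hv]; exact hv⟩, hD v hv⟩
    · rintro ⟨⟨hwδ, hwε⟩, hwD⟩
      obtain ⟨-, hu, hm⟩ := hDS hwD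
      have h := straighten_eq_helmholtz hs hu hm
      have hRw : ‖R w‖ < ε := by
        change ‖helmholtz hs w‖ < ε
        rwa [← h]
      exact ⟨R w, mem_ball_zero_iff.2 hRw, (huniq (R w) w hRw hwδ h).symm⟩
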